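/- Let $m_1<m_2<\cdots$ be integers and $q>1$ a real number with $m_{k+1}/m_k\ge q$ for all $k\ge 1$, and let $(a_{k,n})_{1\le k\le n}$ be a triangular array of real numbers. For $n\ge1$ put $$S_n^T(x)=\sum_{k=1}^n a_{k,n}\cos(2\pi m_k x)\quad(0\le x\le 1),\qquad A_n=\Big(\tfrac12\sum_{k=1}^n a_{k,n}^2\Big)^{1/2},\qquad d_n=\max_{1\le k\le n}|a_{k,n}|,$$ and regard $S_n^T$ as a random variable on $[0,1]$ with Lebesgue measure. Assume that $A_n\to\infty$ and that there is an $\varepsilon>0$ such that, as $n\to\infty$, $$n^{1+\varepsilon}d_n^3\to 0\ \text{ if } 1<q\le 2,\qquad n^{1+\varepsilon}d_n^4\to 0\ \text{ if } q>2 .$$ Then $S_n^T$ converges mod-Gaussian with normalizing sequence $(A_n)$; that is, with $\varphi_n(i\lambda)=\int_0^1 e^{i\lambda S_n^T(x)}\,dx$: (H1) for every $\lambda\in\mathbb R$, $\varphi_n(i\lambda/A_n)\to e^{-\lambda^2/2}$ as $n\to\infty$; (H2) for every $K\ge 0$, the sequence of functions $\lambda\mapsto\varphi_n(i\lambda/A_n)\,\mathbf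 1_{\{|\lambda|\le A_nK\}}$ is uniformly integrable on $\mathbb R$ with Lebesgue measure (bounded in $L^1$, with uniformly absolutely continuous integrals, and with uniformly small $L^1$-mass outside suitable sets of finite measure). -/

import Mathlib

open MeasureTheory ProbabilityTheory Filter Topology

/-- The integers `m 1 < m 2 < ⋯` satisfy `m (k+1) / m k ≥ q > 1` for all `k ≥ 1`.
The value `m 0` plays no role. (The two conditions force `m k > 0` for every `k ≥ 1`.) -/
def IsLacunary (m : ℕ → ℤ) (q : ℝ) : Prop :=
  1 < q ∧ StrictMonoOn m (Set.Ici 1) ∧ ∀ k : ℕ, 1 ≤ k → q ≤ (m (k + 1) : ℝ) / (m k : ℝ)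

/-- The sum `∑_{k=1}^n a_{k,n} cos (2 π m_k x)` as a function of `x ∈ [0,1]`; `a k n` is the entry
`a_{k,n}` of a triangular array, of which only the entries with `1 ≤ k ≤ n` are used. -/
noncomputable def trigSum (a : ℕ → ℕ → ℝ) (m : ℕ → ℤ) (n : ℕ) (x : unitInterval) : ℝ :=
  ∑ k ∈ Finset.Icc 1 n, a k n * Real.cos (2 * Real.pi * (m k : ℝ) * (x : ℝ))

/-- `A_n = (½ ∑_{k=1}^n a_{k,n}²)^{1/2}`. -/
noncomputable def trigScale (a : ℕ → ℕ → ℝ) (n : ℕ) : ℝ :=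
  Real.sqrt ((1 / 2) * ∑ k ∈ Finset.Icc 1 n, a k n ^ 2)

/-- `d_n = max_{1 ≤ k ≤ n} |a_{k,n}|` (and `d_0 = 0`). -/
noncomputable def maxCoeff (a : ℕ → ℕ → ℝ) (n : ℕ) : ℝ :=
  ((Finset.Icc 1 n).sup (fun k => ‖a k n‖₊) : NNReal)

/-- The function `t ↦ φ_n(i t / A_n) 𝟙_{|t| ≤ A_n K}` on the real line, for the random
variable `X = X_n` and `A = A_n`, where `φ_n(z) = 𝔼[exp (z X_n)]`. -/
noncomputable def truncatedCharFun {Ω : Type*} [MeasurableSpace Ω] (P : Measure Ω)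
    (X : Ω → ℝ) (A K : ℝ) : ℝ → ℂ :=
  Set.indicator {t : ℝ | |t| ≤ A * K}
    (fun t => complexMGF X P (Complex.I * (t : ℂ) / (A : ℂ)))

/-- Mod-Gaussian convergence of a sequence `X` of real random variables, along the normalizing
sequence `A`. Uniform integrability on the line (a space of infinite measure) includes
that no mass escapes to infinity, which is `UnifTight` in Mathlib. -/
structure ModGaussianConvergence {Ω : Type*} [MeasurableSpace Ω] (P : Measure Ω)
    [IsProbabilityMeasure P] (X : ℕ → Ω → ℝ) (A : ℕ → ℝ) : Prop where
  aemeasurable : ∀ n, AEMeasurable (X n) P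
  tendsto_scale : Tendsto A atTop atTop
  /-- Condition (H1). -/
  tendsto_charFun : ∀ t : ℝ,
    Tendsto (fun n => complexMGF (X n) P (Complex.I * (t : ℂ) / (A n : ℂ))) atTop
      (𝓝 (Complex.exp (-(t : ℂ) ^ 2 / 2)))
  /-- Condition (H2). -/
  uniformIntegrable : ∀ K : ℝ, 0 ≤ K →
    UniformIntegrable (fun n => truncatedCharFun P (X n) (A n) K) 1 (volume : Measure ℝ) ∧
    UnifTight (fun n => truncatedCharFun P (X n) (A n) K) 1 (volume : Measure ℝ)

/-!
With `u = t / A_n`, the identity `exp z = (1 + z) exp (z - log (1 + z))` for `z = i u a_k cos θ_k`,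
`θ_k = 2 π m_k x`, gives the factorization `exp (i u S_n) = P * exp (-t² / 2) * exp Z`
(`exp_sum_eq`), in which `P = ∏ (1 + i u a_k cos θ_k)` is a Riesz product and `Z` (`expRemainder`)
is a sum of small lacunary cosine sums and of terms of order at least four.

*Riesz products.* All Fourier coefficients of `P` are at most `2` in modulus and its mean is close
to `1` (`exists_norm_rieszCoeff_le`). The coefficient at `N` is a weighted count of representations
`N = ∑ ±m_k`, sorted by the largest index `j`. If `m_j` is comparable with `|N|`, there are boundedly
many choices for `j`. If `m_j` is much larger than `|N|`, all `n` indices may be possible, but the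
next two indices are then confined to a bounded number of choices, because `m_j` and `m_j ± m_i`
both have to be compensated; the contribution is of order `n d³`. For `q > 2` the second case does
not occur, since `m_1 + ⋯ + m_{j-1} ≤ m_j / (q - 1)` is smaller than `m_j` by a fixed factor.

*Exponential moments.* Since `exp y ≤ (1 + y) exp (2 y²)` for small `y`, the same bound applied to
real Riesz products shows that `Z` has bounded exponential moments of order `n ^ τ` for some `τ > 0`
(`integral_exp_expRemainder_le`); here `n ^ (1 + 2 τ) d⁴ → 0` is used.

*Characteristic function.* As `|P exp (-t² / 2)| = |exp (-Z)|`, replacing `exp Z` by its Taylor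
polynomial of degree `p - 1` costs `O (n ^ (-τ p))` (`norm_integral_sub_taylor_le`). For `p = 1` the
mean of `P` remains, and this gives (H1). For general `p`, the mean of `P` times the Taylor
polynomial is `O (n ^ p)`, because `Z` has norm at most `n` in the Wiener algebra and the Fourier
coefficients of `P` are bounded. Hence `|φ_n|` is at most `2 exp (-t² / 2) + O (n ^ (-τ))` and at most
`O (n ^ p) exp (-t² / 2) + O (n ^ (-τ p))`. The first estimate for `|t| ≤ n ^ (τ / 2)` and the second
one beyond give domination by an integrable Gaussian up to an error that tends to `0` in `L¹`, so
that the truncated characteristic functions converge in `L¹`; (H2) is the converse part of Vitali's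
theorem.
-/

/-! ### Lacunary sequences -/

namespace IsLacunary

variable {m : ℕ → ℤ} {q : ℝ}

lemma pos (hm : IsLacunary m q) {k : ℕ} (hk : 1 ≤ k) : (0 : ℝ) < m k := by
  obtain ⟨hq, hmono, hrat⟩ := hm
  have hlt : m k < m (k + 1) :=
    hmono (Set.mem_Ici.2 hk) (Set.mem_Ici.2 (by omega)) (Nat.lt_succ_self k)
  have hlt' : (m k : ℝ) < m (k + 1) := by exact_mod_cast hlt
  have h := hrat k hk
  rcases lt_trichotomy (m k : ℝ) 0 with h0 | h0 | h0
  · rw [le_div_iff_of_neg h0] at h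
    nlinarith
  · rw [h0, div_zero] at h
    linarith
  · exact h0

lemma mul_le (hm : IsLacunary m q) {k : ℕ} (hk : 1 ≤ k) : q * m k ≤ m (k + 1) :=
  (le_div_iff₀ (hm.pos hk)).1 (hm.2.2 k hk)

lemma pow_mul_le (hm : IsLacunary m q) {k : ℕ} (hk : 1 ≤ k) (l : ℕ) :
    q ^ l * m k ≤ m (k + l) := by
  induction l with
  | zero => simp
  | succ l ih =>
    have h1 := hm.mul_le (k := k + l) (by omega)
    have hq := hm.1
    calc q ^ (l + 1) * m k = q * (q ^ l * m k) := by ring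
      _ ≤ q * m (k + l) := by gcongr
      _ ≤ _ := h1

lemma le_of_le (hm : IsLacunary m q) {i j : ℕ} (hi : 1 ≤ i) (hij : i ≤ j) :
    (m i : ℝ) ≤ m j := by
  exact_mod_cast hm.2.1.monotoneOn (Set.mem_Ici.2 hi) (Set.mem_Ici.2 (hi.trans hij)) hij

lemma mul_le_of_lt (hm : IsLacunary m q) {i j : ℕ} (hi : 1 ≤ i) (hij : i < j) :
    q * m i ≤ m j :=
  (hm.mul_le hi).trans (hm.le_of_le (by omega) hij)

/-- Multiplying all frequencies by a positive integer preserves lacunarity. -/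
lemma const_mul (hm : IsLacunary m q) {c : ℤ} (hc : 0 < c) :
    IsLacunary (fun k => c * m k) q := by
  refine ⟨hm.1, fun i hi j hj hij => mul_lt_mul_of_pos_left (hm.2.1 hi hj hij) hc, ?_⟩
  intro k hk
  have hc' : (c : ℝ) ≠ 0 := by exact_mod_cast hc.ne'
  push_cast
  rw [mul_div_mul_left _ _ hc']
  exact hm.2.2 k hk

/-- Terms of a lacunary sequence whose pairwise ratios are at most `ρ` are bounded in number. -/
lemma card_le (hm : IsLacunary m q) {ρ : ℝ} {L : ℕ} (hL : ρ < q ^ L) {s : Finset ℕ}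
    (hs : ∀ i ∈ s, 1 ≤ i) (h : ∀ i ∈ s, ∀ j ∈ s, (m i : ℝ) ≤ ρ * m j) : s.card ≤ L := by
  rcases s.eq_empty_or_nonempty with rfl | hne
  · simp
  set i₀ := s.min' hne with hi₀
  have hi₀s : i₀ ∈ s := s.min'_mem hne
  have hsub : s ⊆ Finset.Ico i₀ (i₀ + L) := by
    intro i hi
    have h0 : i₀ ≤ i := s.min'_le i hi
    refine Finset.mem_Ico.2 ⟨h0, ?_⟩
    by_contra hcon
    push Not at hcon
    have h1 := hm.pow_mul_le (hs _ hi₀s) L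
    have h2 : (m (i₀ + L) : ℝ) ≤ m i := hm.le_of_le (by have := hs _ hi₀s; omega) hcon
    have h3 := h i hi i₀ hi₀s
    have h4 := mul_lt_mul_of_pos_right hL (hm.pos (hs _ hi₀s))
    linarith
  simpa using Finset.card_le_card hsub

end IsLacunary

/-! ### Fourier coefficients of Riesz products -/

/-- `rieszCoeff w m k N` is the Fourier coefficient at the frequency `N` of the Riesz product
`∏_{j=1}^k (1 + w_j cos (2 π m_j x))`, defined by recursion on the number of factors. -/
noncomputable def rieszCoeff (w : ℕ → ℂ) (m : ℕ → ℤ) : ℕ → ℤ → ℂ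
  | 0, N => if N = 0 then 1 else 0
  | k + 1, N => rieszCoeff w m k N + w (k + 1) / 2 *
      (rieszCoeff w m k (N - m (k + 1)) + rieszCoeff w m k (N + m (k + 1)))

section RieszCoeff

variable {w : ℕ → ℂ} {m : ℕ → ℤ} {q : ℝ}

/-- Sorting the representations of `N` by their largest index `j`. -/
lemma rieszCoeff_eq_sum (w : ℕ → ℂ) (m : ℕ → ℤ) (k : ℕ) (N : ℤ) :
    rieszCoeff w m k N = (if N = 0 then 1 else 0) + ∑ j ∈ Finset.Icc 1 k, w j / 2 *
      (rieszCoeff w m (j - 1) (N - m j) + rieszCoeff w m (j - 1) (N + m j)) := by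
  induction k with
  | zero => simp [rieszCoeff]
  | succ k ih =>
    rw [Finset.sum_Icc_succ_top (by omega), ← add_assoc, ← ih, Nat.add_sub_cancel, rieszCoeff]

/-- The coefficients live on frequencies of size at most `m_1 + ⋯ + m_k ≤ m_{k+1} / (q - 1)`. -/
lemma rieszCoeff_eq_zero (hm : IsLacunary m q) (k : ℕ) {N : ℤ}
    (hN : (m (k + 1) : ℝ) < (q - 1) * |(N : ℝ)|) : rieszCoeff w m k N = 0 := by
  induction k generalizing N with
  | zero =>
    have h1 := hm.pos le_rfl
    have : N ≠ 0 := by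
      rintro rfl
      simp at hN
      simp at h1
      linarith
    simp [rieszCoeff, this]
  | succ k ih =>
    have hq := hm.1
    have hp := hm.pos (k := k + 1) (by omega)
    have hl := hm.mul_le (k := k + 1) (by omega)
    have key : ∀ N' : ℤ, |(N : ℝ)| - m (k + 1) ≤ |(N' : ℝ)| → rieszCoeff w m k N' = 0 := by
      intro N' h'
      apply ih
      nlinarith
    rw [rieszCoeff, key N (by linarith), key (N - m (k + 1)), key (N + m (k + 1))]
    · simp
    · push_cast
      have := abs_sub_abs_le_abs_sub (N : ℝ) (-(m (k + 1) : ℝ))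
      rw [abs_neg, abs_of_pos hp, sub_neg_eq_add] at this
      exact this
    · push_cast
      have := abs_sub_abs_le_abs_sub (N : ℝ) (m (k + 1) : ℝ)
      rwa [abs_of_pos hp] at this

lemma abs_sub_le_abs_intCast_sub_add (hm : IsLacunary m q) {j : ℕ} (hj : 1 ≤ j) (N : ℤ) :
    |(N : ℝ)| - m j ≤ |((N - m j : ℤ) : ℝ)| ∧ |(N : ℝ)| - m j ≤ |((N + m j : ℤ) : ℝ)| ∧
    (m j : ℝ) - |(N : ℝ)| ≤ |((N - m j : ℤ) : ℝ)| ∧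
    (m j : ℝ) - |(N : ℝ)| ≤ |((N + m j : ℤ) : ℝ)| := by
  have hp := hm.pos hj
  push_cast
  refine ⟨?_, ?_, ?_, ?_⟩ <;>
    cases abs_cases (N : ℝ) <;> cases abs_cases ((N : ℝ) - m j) <;>
      cases abs_cases ((N : ℝ) + m j) <;> linarith

/-- The two coefficients multiplying `w_j / 2` vanish unless `m_j` is comparable with `|N|` or
larger. -/
lemma rieszCoeff_pair_eq_zero (hm : IsLacunary m q) {j : ℕ} (hj : 1 ≤ j) {N : ℤ}
    (h : q * m j < (q - 1) * |(N : ℝ)|) :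
    rieszCoeff w m (j - 1) (N - m j) = 0 ∧ rieszCoeff w m (j - 1) (N + m j) = 0 := by
  obtain ⟨h1, h2, -, -⟩ := abs_sub_le_abs_intCast_sub_add hm hj N
  have hq := hm.1
  constructor <;> apply rieszCoeff_eq_zero hm <;> rw [Nat.sub_add_cancel hj] <;> nlinarith

lemma norm_half_mul_add_le {η V : ℝ} {z a b : ℂ} (hη : 0 ≤ η) (hz : ‖z‖ ≤ η) (ha : ‖a‖ ≤ V)
    (hb : ‖b‖ ≤ V) : ‖z / 2 * (a + b)‖ ≤ η * V := by
  have hab : ‖a + b‖ ≤ V + V := (norm_add_le a b).trans (add_le_add ha hb)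
  calc ‖z / 2 * (a + b)‖ = ‖z‖ / 2 * ‖a + b‖ := by simp
    _ ≤ η / 2 * (V + V) := by gcongr
    _ = η * V := by ring

lemma norm_sum_le_of_support {ι : Type*} [DecidableEq ι] {s t : Finset ι} {f : ι → ℂ} {B : ℝ}
    {L : ℕ} (hB : 0 ≤ B) (hcard : t.card ≤ L) (hf : ∀ i ∈ s, ‖f i‖ ≤ B) (hts : t ⊆ s)
    (h0 : ∀ i ∈ s, i ∉ t → f i = 0) : ‖∑ i ∈ s, f i‖ ≤ L * B := by
  rw [← Finset.sum_subset hts h0]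
  calc ‖∑ i ∈ t, f i‖ ≤ ∑ i ∈ t, B := norm_sum_le_of_le _ fun i hi => hf i (hts hi)
    _ = t.card * B := by simp
    _ ≤ L * B := by gcongr

/-- If the frequency `N` is at least of the order of all available `m_j`, then only boundedly many
indices can be the largest one of a representation of `N`. -/
lemma norm_rieszCoeff_le_of_large (hm : IsLacunary m q) {η c Q V : ℝ} {k L : ℕ} {N : ℤ}
    (hη : 0 ≤ η) (hc : 0 < c) (hL : q / ((q - 1) * c) < q ^ L)
    (hw : ∀ j ∈ Finset.Icc 1 k, ‖w j‖ ≤ η) (hQ : 0 < Q) (hkQ : ∀ j ∈ Finset.Icc 1 k, (m j : ℝ) ≤ Q)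
    (hN : c * Q ≤ |(N : ℝ)|) (hV0 : 0 ≤ V)
    (hV : ∀ j ∈ Finset.Icc 1 k, ‖rieszCoeff w m (j - 1) (N - m j)‖ ≤ V ∧
      ‖rieszCoeff w m (j - 1) (N + m j)‖ ≤ V) :
    ‖rieszCoeff w m k N‖ ≤ L * (η * V) := by
  have hq := hm.1
  have hN0 : N ≠ 0 := by
    rintro rfl
    simp at hN
    nlinarith [mul_pos hc hQ]
  rw [rieszCoeff_eq_sum, if_neg hN0, zero_add]
  refine norm_sum_le_of_support (t := (Finset.Icc 1 k).filter
    fun j => (q - 1) * |(N : ℝ)| ≤ q * m j) (by positivity) ?_ ?_ (Finset.filter_subset _ _) ?_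
  · refine hm.card_le hL (fun i hi => (Finset.mem_Icc.1 (Finset.mem_filter.1 hi).1).1) ?_
    intro i hi j hj
    have h1 := hkQ i (Finset.mem_filter.1 hi).1
    have h2 := (Finset.mem_filter.1 hj).2
    have hq1 : 0 < q - 1 := by linarith
    have h3 : (q - 1) * (c * Q) ≤ q * m j := (mul_le_mul_of_nonneg_left hN hq1.le).trans h2
    rw [div_mul_eq_mul_div, le_div_iff₀ (by positivity)]
    nlinarith [mul_pos hq1 hc]
  · intro j hj
    exact norm_half_mul_add_le hη (hw j hj) (hV j hj).1 (hV j hj).2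
  · intro j hj hj'
    have h1 : q * m j < (q - 1) * |(N : ℝ)| := by
      by_contra hcon
      exact hj' (Finset.mem_filter.2 ⟨hj, not_lt.1 hcon⟩)
    obtain ⟨ha, hb⟩ := rieszCoeff_pair_eq_zero (w := w) hm (Finset.mem_Icc.1 hj).1 h1
    rw [ha, hb]
    simp

/-- An index `j` with `m_j` much larger than `|N|` contributes little to the coefficient at `N`:
after `m_j`, the two next largest frequencies have to be comparable with `m_j`, because
`m_j - m_i` is itself comparable with `m_j`. -/
lemma norm_rieszCoeff_pair_le_of_far (hm : IsLacunary m q) {η c : ℝ} {j L : ℕ} {N : ℤ}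
    (hη : 0 ≤ η) (hc : c = (q - 1) / (2 * q)) (hL : q / ((q - 1) * c) < q ^ L) (hj : 1 ≤ j)
    (hw : ∀ i ∈ Finset.Icc 1 (j - 1), ‖w i‖ ≤ η) (hN : |(N : ℝ)| ≤ c * m j)
    (hV : ∀ i < j, ∀ M, ‖rieszCoeff w m i M‖ ≤ 2) :
    ‖rieszCoeff w m (j - 1) (N - m j)‖ ≤ L * (η * (L * (η * 2))) ∧
      ‖rieszCoeff w m (j - 1) (N + m j)‖ ≤ L * (η * (L * (η * 2))) := by
  have hq := hm.1
  have hq1 : 0 < q - 1 := by linarith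
  have hc0 : 0 < c := by rw [hc]; positivity
  have hcq : 2 * (q * c) = q - 1 := by rw [hc]; field_simp
  have hQ := hm.pos hj
  have hle : ∀ i ∈ Finset.Icc 1 (j - 1), (m i : ℝ) ≤ m j := fun i hi => by
    have := Finset.mem_Icc.1 hi
    exact hm.le_of_le this.1 (by omega)
  -- The second step: `M` is `N ± m_j`, and `M ± m_i` is again of the order of `m_j`.
  have step : ∀ M : ℤ, (m j : ℝ) - |(N : ℝ)| ≤ |(M : ℝ)| →
      ‖rieszCoeff w m (j - 1) M‖ ≤ L * (η * (L * (η * 2))) := by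
    intro M hM
    have hcm : 2 * c * m j ≤ (1 - 1 / q) * m j := by
      have : 2 * c = 1 - 1 / q := by rw [hc]; field_simp
      rw [this]
    have hM1 : c * m j ≤ |(M : ℝ)| := by
      have : (0:ℝ) ≤ 1 / q * m j := by positivity
      nlinarith
    refine norm_rieszCoeff_le_of_large hm hη hc0 hL hw hQ hle hM1 (by positivity) ?_
    intro i hi
    have hi' := Finset.mem_Icc.1 hi
    have hqi : (m i : ℝ) ≤ 1 / q * m j := by
      rw [div_mul_eq_mul_div, one_mul, le_div_iff₀ (by linarith), mul_comm]
      exact hm.mul_le_of_lt hi'.1 (by omega)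
    obtain ⟨h1, h2, -, -⟩ := abs_sub_le_abs_intCast_sub_add hm hi'.1 M
    have hsub : ∀ l ∈ Finset.Icc 1 (i - 1), l ∈ Finset.Icc 1 (j - 1) := fun l hl => by
      have := Finset.mem_Icc.1 hl
      exact Finset.mem_Icc.2 ⟨this.1, by omega⟩
    have fin : ∀ M' : ℤ, |(M : ℝ)| - m i ≤ |(M' : ℝ)| →
        ‖rieszCoeff w m (i - 1) M'‖ ≤ L * (η * 2) := by
      intro M' hM'
      refine norm_rieszCoeff_le_of_large hm hη hc0 hL (fun l hl => hw l (hsub l hl)) hQ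
        (fun l hl => hle l (hsub l hl)) (by linarith) (by norm_num) ?_
      intro l hl
      have := Finset.mem_Icc.1 hl
      exact ⟨hV _ (by omega) _, hV _ (by omega) _⟩
    exact ⟨fin _ h1, fin _ h2⟩
  obtain ⟨-, -, h3, h4⟩ := abs_sub_le_abs_intCast_sub_add hm hj N
  exact ⟨step _ h3, step _ h4⟩

/-- For `q > 2` no index is far larger than the frequency it helps to represent. -/
lemma rieszCoeff_pair_eq_zero_of_far (hm : IsLacunary m q) {j : ℕ} (hj : 1 ≤ j) {N : ℤ}
    (h : (q - 1) * |(N : ℝ)| < (q - 2) * m j) :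
    rieszCoeff w m (j - 1) (N - m j) = 0 ∧ rieszCoeff w m (j - 1) (N + m j) = 0 := by
  obtain ⟨-, -, h1, h2⟩ := abs_sub_le_abs_intCast_sub_add hm hj N
  have hq := hm.1
  constructor <;> apply rieszCoeff_eq_zero hm <;> rw [Nat.sub_add_cancel hj] <;> nlinarith

end RieszCoeff

/-- All Fourier coefficients of a Riesz product with small weights are bounded by `2`, and the
mean is close to `1`. For `q ≤ 2` the smallness required is that of `n η³`, the contribution of the
relations `±m_i ± m_j ± m_l = 0`; for `q > 2` there is no nontrivial relation with
coefficients in `{-1, 0, 1}`, so that the mean equals `1`. -/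
theorem exists_norm_rieszCoeff_le {q : ℝ} (hq : 1 < q) :
    ∃ C : ℝ, 0 < C ∧ ∀ (m : ℕ → ℤ), IsLacunary m q → ∀ (w : ℕ → ℂ) (n : ℕ) (η : ℝ), 0 ≤ η →
      (∀ k ∈ Finset.Icc 1 n, ‖w k‖ ≤ η) → C * η ≤ 1 → (q ≤ 2 → C * (n * η ^ 3) ≤ 1) →
      (∀ N, ‖rieszCoeff w m n N‖ ≤ 2) ∧
        ‖rieszCoeff w m n 0 - 1‖ ≤ if q ≤ 2 then C * (n * η ^ 3) else 0 := by
  have hq1 : 0 < q - 1 := by linarith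
  obtain ⟨c, hc⟩ : ∃ c, c = (q - 1) / (2 * q) := ⟨_, rfl⟩
  have hc0 : 0 < c := by rw [hc]; positivity
  obtain ⟨c', hc'0, hc'c, hc'2⟩ : ∃ c' : ℝ, 0 < c' ∧ c' ≤ c ∧ (2 < q → (q - 1) * c' < q - 2) := by
    by_cases h2 : 2 < q
    · have h3 : 0 < (q - 2) / (2 * (q - 1)) := div_pos (by linarith) (by linarith)
      refine ⟨min c ((q - 2) / (2 * (q - 1))), lt_min hc0 h3, min_le_left _ _, fun _ => ?_⟩
      calc (q - 1) * min c ((q - 2) / (2 * (q - 1)))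
          ≤ (q - 1) * ((q - 2) / (2 * (q - 1))) := by gcongr; exact min_le_right _ _
        _ = (q - 2) / 2 := by field_simp
        _ < q - 2 := by linarith
    · exact ⟨c, hc0, le_rfl, fun h => absurd h h2⟩
  obtain ⟨L, hL'⟩ := pow_unbounded_of_one_lt (q / ((q - 1) * c')) hq
  have hL : q / ((q - 1) * c) < q ^ L := by
    refine lt_of_le_of_lt ?_ hL'
    gcongr
  refine ⟨4 * ((L : ℝ) + 1) ^ 2, by positivity, ?_⟩
  intro m hm w n η hη hw hCη hCn
  set B : ℝ := η * (L * (η * (L * (η * 2)))) with hB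
  have hB0 : 0 ≤ B := by positivity
  set F : ℝ := if q ≤ 2 then (n : ℝ) else 0 with hF
  have hF0 : 0 ≤ F := by rw [hF]; split_ifs <;> positivity
  have hFB : F * B ≤ if q ≤ 2 then 4 * ((L : ℝ) + 1) ^ 2 * (n * η ^ 3) else 0 := by
    rw [hF]
    split_ifs
    · calc (n : ℝ) * B = 2 * L ^ 2 * (n * η ^ 3) := by rw [hB]; ring
        _ ≤ 4 * ((L : ℝ) + 1) ^ 2 * (n * η ^ 3) := by
          gcongr
          · norm_num
          · linarith
    · simp
  have hFB' : F * B ≤ 1 / 2 := by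
    rw [hF]
    split_ifs with h2
    · have := hCn h2
      have hn : (0 : ℝ) ≤ n * η ^ 3 := by positivity
      calc (n : ℝ) * B = 2 * L ^ 2 * (n * η ^ 3) := by rw [hB]; ring
        _ ≤ 2 * ((L : ℝ) + 1) ^ 2 * (n * η ^ 3) := by
          gcongr
          linarith
        _ ≤ 1 / 2 := by linarith
    · norm_num
  have hLη : L * (η * 2) ≤ 1 / 2 := by
    have hL0 : (0 : ℝ) ≤ L := by positivity
    nlinarith [mul_nonneg hL0 hη, mul_nonneg (mul_nonneg hL0 hL0) hη]
  have key : ∀ k ≤ n, ∀ N : ℤ, ‖rieszCoeff w m k N - if N = 0 then 1 else 0‖ ≤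
      (if N = 0 then 0 else L * (η * 2)) + F * B := by
    intro k
    induction k using Nat.strong_induction_on with
    | _ k ih =>
    intro hkn N
    have hV : ∀ i < k, ∀ M, ‖rieszCoeff w m i M‖ ≤ 2 := by
      intro i hi M
      have h1 := ih i hi (by omega) M
      have h2 : ‖(if M = 0 then 1 else 0 : ℂ)‖ ≤ 1 := by split_ifs <;> simp
      have h3 : (if M = 0 then 0 else (L : ℝ) * (η * 2)) ≤ 1 / 2 := by
        split_ifs
        · norm_num
        · exact hLη
      have h4 := norm_add_le (rieszCoeff w m i M - if M = 0 then 1 else 0)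
        (if M = 0 then 1 else 0)
      rw [sub_add_cancel] at h4
      linarith
    have hmem : ∀ j ∈ Finset.Icc 1 k, 1 ≤ j ∧ j ≤ k ∧ ‖w j‖ ≤ η := fun j hj => by
      have := Finset.mem_Icc.1 hj
      exact ⟨this.1, this.2, hw j (Finset.mem_Icc.2 ⟨this.1, by omega⟩)⟩
    rw [rieszCoeff_eq_sum, add_sub_cancel_left,
      ← Finset.sum_filter_add_sum_filter_not _ (fun j => c' * m j < |(N : ℝ)|)]
    refine (norm_add_le _ _).trans (add_le_add ?_ ?_)
    · -- Indices with `m_j` at most of the order of `|N|`.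
      by_cases hN : N = 0
      · rw [if_pos hN, Finset.sum_eq_zero, norm_zero]
        intro j hj
        obtain ⟨hj1, hj2⟩ := Finset.mem_filter.1 hj
        have := hm.pos (hmem j hj1).1
        rw [hN, Int.cast_zero, abs_zero] at hj2
        exact absurd hj2 (not_lt.2 (by positivity))
      rw [if_neg hN]
      refine norm_sum_le_of_support (t := ((Finset.Icc 1 k).filter
        (fun j => c' * m j < |(N : ℝ)|)).filter
        fun j => (q - 1) * |(N : ℝ)| ≤ q * m j) (by positivity) ?_ ?_ (Finset.filter_subset _ _) ?_
      · refine hm.card_le hL' (fun i hi => ?_) ?_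
        · exact (hmem i (Finset.mem_filter.1 (Finset.mem_filter.1 hi).1).1).1
        intro i hi j hj
        have h1 := (Finset.mem_filter.1 (Finset.mem_filter.1 hi).1).2
        have h2 := (Finset.mem_filter.1 hj).2
        rw [div_mul_eq_mul_div, le_div_iff₀ (by positivity)]
        nlinarith
      · intro j hj
        obtain ⟨h1, h2, h3⟩ := hmem j (Finset.mem_filter.1 hj).1
        exact norm_half_mul_add_le hη h3 (hV _ (by omega) _) (hV _ (by omega) _)
      · intro j hj hj'
        have h1 : q * m j < (q - 1) * |(N : ℝ)| := by
          by_contra hcon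
          exact hj' (Finset.mem_filter.2 ⟨hj, not_lt.1 hcon⟩)
        obtain ⟨ha, hb⟩ := rieszCoeff_pair_eq_zero (w := w) hm
          (hmem j (Finset.mem_filter.1 hj).1).1 h1
        rw [ha, hb]
        simp
    · -- Indices with `m_j` much larger than `|N|`.
      rw [hF]
      split_ifs with h2
      · refine norm_sum_le_of_support hB0 (t := (Finset.Icc 1 k).filter
          (fun j => ¬ c' * m j < |(N : ℝ)|)) ?_ ?_ subset_rfl (fun i hi hi' => absurd hi hi')
        · calc _ ≤ (Finset.Icc 1 k).card := Finset.card_filter_le _ _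
            _ = k := by simp
            _ ≤ n := hkn
        · intro j hj
          obtain ⟨hj1, hj2⟩ := Finset.mem_filter.1 hj
          obtain ⟨h1, h2, h3⟩ := hmem j hj1
          have hmj := hm.pos h1
          have hfar := norm_rieszCoeff_pair_le_of_far (w := w) (N := N) hm hη hc hL h1
            (fun i hi => by
              have := Finset.mem_Icc.1 hi
              exact (hmem i (Finset.mem_Icc.2 ⟨this.1, by omega⟩)).2.2)
            ((not_lt.1 hj2).trans (by gcongr)) (fun i hi => hV i (by omega))
          exact norm_half_mul_add_le hη h3 hfar.1 hfar.2
      · rw [Finset.sum_eq_zero]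
        · simp
        intro j hj
        obtain ⟨hj1, hj2⟩ := Finset.mem_filter.1 hj
        have hmj := hm.pos (hmem j hj1).1
        obtain ⟨ha, hb⟩ := rieszCoeff_pair_eq_zero_of_far (w := w) (N := N) hm
          (hmem j hj1).1 (by
            have := hc'2 (not_le.1 h2)
            have h5 := not_lt.1 hj2
            calc (q - 1) * |(N : ℝ)| ≤ (q - 1) * (c' * m j) := by gcongr
              _ = (q - 1) * c' * m j := by ring
              _ < (q - 2) * m j := by gcongr)
        rw [ha, hb]
        simp
  constructor
  · intro N
    have h1 := key n le_rfl N
    have h2 : ‖(if N = 0 then 1 else 0 : ℂ)‖ ≤ 1 := by split_ifs <;> simp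
    have h3 : (if N = 0 then 0 else (L : ℝ) * (η * 2)) ≤ 1 / 2 := by
      split_ifs
      · norm_num
      · exact hLη
    have h4 := norm_add_le (rieszCoeff w m n N - if N = 0 then 1 else 0)
      (if N = 0 then 1 else 0)
    rw [sub_add_cancel] at h4
    linarith
  · have h1 := key n le_rfl 0
    simp only [if_true, zero_add] at h1
    exact h1.trans hFB

/-! ### Riesz products as functions -/

/-- The character `x ↦ exp (2 π i N x)` of the unit interval. -/
noncomputable def unitChar (N : ℤ) (x : unitInterval) : ℂ :=
  Complex.exp (2 * Real.pi * Complex.I * N * (x : ℝ))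

/-- The function `x ↦ cos (2 π N x)` on the unit interval. -/
noncomputable def unitCos (N : ℤ) (x : unitInterval) : ℝ :=
  Real.cos (2 * Real.pi * (N : ℝ) * (x : ℝ))

/-- The Riesz product `∏_{k=1}^n (1 + w_k cos (2 π m_k x))`. -/
noncomputable def rieszProd (w : ℕ → ℂ) (m : ℕ → ℤ) (n : ℕ) (x : unitInterval) : ℂ :=
  ∏ k ∈ Finset.Icc 1 n, (1 + w k * unitCos (m k) x)

@[fun_prop]
lemma continuous_unitChar (N : ℤ) : Continuous (unitChar N) := by
  unfold unitChar; fun_prop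

@[fun_prop]
lemma continuous_unitCos (N : ℤ) : Continuous (unitCos N) := by
  unfold unitCos; fun_prop

@[fun_prop]
lemma continuous_rieszProd (w : ℕ → ℂ) (m : ℕ → ℤ) (n : ℕ) : Continuous (rieszProd w m n) := by
  unfold rieszProd; fun_prop

lemma abs_unitCos_le (N : ℤ) (x : unitInterval) : |unitCos N x| ≤ 1 := Real.abs_cos_le_one _

lemma norm_unitChar (N : ℤ) (x : unitInterval) : ‖unitChar N x‖ = 1 := by
  rw [unitChar, show 2 * (Real.pi : ℂ) * Complex.I * N * (x : ℝ) =
    ((2 * Real.pi * N * (x : ℝ) : ℝ) : ℂ) * Complex.I by push_cast; ring]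
  exact Complex.norm_exp_ofReal_mul_I _

lemma unitChar_mul (M N : ℤ) (x : unitInterval) :
    unitChar M x * unitChar N x = unitChar (M + N) x := by
  rw [unitChar, unitChar, unitChar, ← Complex.exp_add]
  push_cast
  ring_nf

lemma unitCos_eq (N : ℤ) (x : unitInterval) :
    (unitCos N x : ℂ) = (unitChar N x + unitChar (-N) x) / 2 := by
  rw [unitCos, Complex.ofReal_cos, Complex.cos, unitChar, unitChar]
  push_cast
  ring_nf

/-- Continuous functions on the unit interval are integrable. -/
lemma Continuous.integrable_unitInterval {E : Type*} [NormedAddCommGroup E] {f : unitInterval → E}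
    (hf : Continuous f) : Integrable f :=
  hf.integrable_of_hasCompactSupport (HasCompactSupport.of_compactSpace f)

lemma integral_unitChar (N : ℤ) : ∫ x, unitChar N x = if N = 0 then 1 else 0 := by
  split_ifs with hN
  · simp [unitChar, hN]
  · have h1 : ∫ x, unitChar N x =
        ∫ x in (0 : ℝ)..1, Complex.exp (2 * Real.pi * Complex.I * N * x) := by
      rw [intervalIntegral.integral_of_le zero_le_one, ← integral_Icc_eq_integral_Ioc]
      exact integral_subtype_comap measurableSet_Icc
        fun x : ℝ => Complex.exp (2 * Real.pi * Complex.I * N * x)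
    rw [h1, integral_exp_mul_complex (by simp [hN, Real.pi_ne_zero])]
    have h2 : Complex.exp (2 * Real.pi * Complex.I * N * (1 : ℝ)) = 1 := by
      rw [Complex.exp_eq_one_iff]
      exact ⟨N, by push_cast; ring⟩
    rw [h2]
    simp

lemma integral_rieszProd_mul_unitChar (w : ℕ → ℂ) (m : ℕ → ℤ) (n : ℕ) (N : ℤ) :
    ∫ x, rieszProd w m n x * unitChar N x = rieszCoeff w m n N := by
  induction n generalizing N with
  | zero => simp [rieszProd, rieszCoeff, integral_unitChar]
  | succ n ih =>
    have h : ∀ x, rieszProd w m (n + 1) x * unitChar N x = rieszProd w m n x * unitChar N x +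
        w (n + 1) / 2 * (rieszProd w m n x * unitChar (N - m (n + 1)) x +
          rieszProd w m n x * unitChar (N + m (n + 1)) x) := by
      intro x
      rw [rieszProd, Finset.prod_Icc_succ_top (by omega), ← rieszProd, unitCos_eq, sub_eq_add_neg,
        ← unitChar_mul, ← unitChar_mul]
      ring
    simp_rw [h]
    rw [integral_add (by apply Continuous.integrable_unitInterval; fun_prop)
      (by apply Continuous.integrable_unitInterval; fun_prop), integral_const_mul,
      integral_add (by apply Continuous.integrable_unitInterval; fun_prop)
      (by apply Continuous.integrable_unitInterval; fun_prop), ih, ih, ih, rieszCoeff]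

lemma integral_rieszProd (w : ℕ → ℂ) (m : ℕ → ℤ) (n : ℕ) :
    ∫ x, rieszProd w m n x = rieszCoeff w m n 0 := by
  rw [← integral_rieszProd_mul_unitChar]
  simp [unitChar]

/-! ### Exponential moments of lacunary cosine sums -/

lemma exp_le_one_add_mul_exp {y : ℝ} (hy : |y| ≤ 1 / 5) :
    Real.exp y ≤ (1 + y) * Real.exp (2 * y ^ 2) := by
  obtain ⟨h1, h2⟩ := abs_le.1 hy
  have h3 : |y - 2 * y ^ 2| ≤ 1 := abs_le.2 ⟨by nlinarith, by nlinarith⟩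
  have h4 := (abs_le.1 (Real.abs_exp_sub_one_sub_id_le h3)).2
  have h5 : Real.exp (y - 2 * y ^ 2) ≤ 1 + y := by
    have h6 : (1 - 2 * y) ^ 2 ≤ 2 := by nlinarith
    have h7 : (y - 2 * y ^ 2) ^ 2 = y ^ 2 * (1 - 2 * y) ^ 2 := by ring
    nlinarith [mul_le_mul_of_nonneg_left h6 (sq_nonneg y)]
  calc Real.exp y = Real.exp (y - 2 * y ^ 2) * Real.exp (2 * y ^ 2) := by
        rw [← Real.exp_add]; ring_nf
    _ ≤ _ := by gcongr

/-- The exponential moment of a cosine sum is dominated by the mean of a Riesz product. -/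
lemma integral_exp_sum_le {b : ℕ → ℝ} {m : ℕ → ℤ} {n : ℕ} {V : ℝ}
    (hb : ∀ k ∈ Finset.Icc 1 n, |b k| ≤ 1 / 5)
    (hV : ‖rieszCoeff (fun k => (b k : ℂ)) m n 0‖ ≤ V) :
    ∫ x, Real.exp (∑ k ∈ Finset.Icc 1 n, b k * unitCos (m k) x) ≤
      V * Real.exp (2 * ∑ k ∈ Finset.Icc 1 n, b k ^ 2) := by
  have hy : ∀ x, ∀ k ∈ Finset.Icc 1 n, |b k * unitCos (m k) x| ≤ |b k| := fun x k _ => by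
    rw [abs_mul]
    exact mul_le_of_le_one_right (abs_nonneg _) (abs_unitCos_le _ _)
  have hpt : ∀ x, Real.exp (∑ k ∈ Finset.Icc 1 n, b k * unitCos (m k) x) ≤
      (∏ k ∈ Finset.Icc 1 n, (1 + b k * unitCos (m k) x)) *
        Real.exp (2 * ∑ k ∈ Finset.Icc 1 n, b k ^ 2) := by
    intro x
    have hnn : ∀ k ∈ Finset.Icc 1 n, 0 ≤ 1 + b k * unitCos (m k) x := fun k hk => by
      linarith [(abs_le.1 ((hy x k hk).trans (hb k hk))).1]
    rw [Real.exp_sum, Finset.mul_sum, Real.exp_sum, ← Finset.prod_mul_distrib]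
    refine Finset.prod_le_prod (fun _ _ => (Real.exp_pos _).le) fun k hk => ?_
    refine (exp_le_one_add_mul_exp ((hy x k hk).trans (hb k hk))).trans ?_
    refine mul_le_mul_of_nonneg_left (Real.exp_le_exp.2 ?_) (hnn k hk)
    linarith [sq_le_sq.2 (hy x k hk)]
  have hre : ((∫ x, ∏ k ∈ Finset.Icc 1 n, (1 + b k * unitCos (m k) x) : ℝ) : ℂ) =
      rieszCoeff (fun k => (b k : ℂ)) m n 0 := by
    rw [← integral_rieszProd, ← integral_complex_ofReal]
    simp [rieszProd]
  calc ∫ x, Real.exp (∑ k ∈ Finset.Icc 1 n, b k * unitCos (m k) x)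
      ≤ ∫ x, (∏ k ∈ Finset.Icc 1 n, (1 + b k * unitCos (m k) x)) *
        Real.exp (2 * ∑ k ∈ Finset.Icc 1 n, b k ^ 2) := by
        refine integral_mono ?_ ?_ hpt <;> apply Continuous.integrable_unitInterval <;> fun_prop
    _ = (∫ x, ∏ k ∈ Finset.Icc 1 n, (1 + b k * unitCos (m k) x)) *
        Real.exp (2 * ∑ k ∈ Finset.Icc 1 n, b k ^ 2) := integral_mul_const _ _
    _ ≤ _ := by
      gcongr
      refine le_trans (le_abs_self _) ?_
      rw [← Real.norm_eq_abs, ← Complex.norm_real, hre]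
      exact hV

lemma integral_exp_abs_sum_le {b : ℕ → ℝ} {m : ℕ → ℤ} {n : ℕ} {V : ℝ}
    (hb : ∀ k ∈ Finset.Icc 1 n, |b k| ≤ 1 / 5)
    (hV : ‖rieszCoeff (fun k => (b k : ℂ)) m n 0‖ ≤ V)
    (hV' : ‖rieszCoeff (fun k => ((-b k : ℝ) : ℂ)) m n 0‖ ≤ V) :
    ∫ x, Real.exp |∑ k ∈ Finset.Icc 1 n, b k * unitCos (m k) x| ≤
      2 * V * Real.exp (2 * ∑ k ∈ Finset.Icc 1 n, b k ^ 2) := by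
  have h1 := integral_exp_sum_le hb hV
  have h2 := integral_exp_sum_le (b := fun k => -b k) (by simpa using hb) hV'
  simp only [neg_mul, Finset.sum_neg_distrib, neg_sq] at h2
  calc _ ≤ ∫ x, (Real.exp (∑ k ∈ Finset.Icc 1 n, b k * unitCos (m k) x) +
        Real.exp (-∑ k ∈ Finset.Icc 1 n, b k * unitCos (m k) x)) := by
        refine integral_mono ?_ ?_ fun x => Real.exp_abs_le _ <;>
          apply Continuous.integrable_unitInterval <;> fun_prop
    _ = _ := by
        refine integral_add ?_ ?_ <;> apply Continuous.integrable_unitInterval <;> fun_prop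
    _ ≤ _ := by linarith

/-! ### Functions with an absolutely convergent Fourier series -/

/-- `WienerLE f B` says that the continuous function `f` has norm at most `B` in the Wiener algebra
of absolutely convergent Fourier series. It is encoded by what is used of it: `|f| ≤ B`, and
multiplication by `f` increases the supremum of the Fourier coefficients of a continuous function
by a factor of at most `B`. -/
def WienerLE (f : unitInterval → ℂ) (B : ℝ) : Prop :=
  Continuous f ∧ (∀ x, ‖f x‖ ≤ B) ∧ ∀ g : unitInterval → ℂ, Continuous g → ∀ M : ℝ,
    (∀ N, ‖∫ x, g x * unitChar N x‖ ≤ M) → ∀ N, ‖∫ x, f x * g x * unitChar N x‖ ≤ B * M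

namespace WienerLE

variable {f g : unitInterval → ℂ} {B C : ℝ}

lemma continuous (hf : WienerLE f B) : Continuous f := hf.1

lemma norm_le (hf : WienerLE f B) (x : unitInterval) : ‖f x‖ ≤ B := hf.2.1 x

lemma nonneg (hf : WienerLE f B) : 0 ≤ B := (norm_nonneg _).trans (hf.norm_le 0)

lemma mono (hf : WienerLE f B) (h : B ≤ C) : WienerLE f C := by
  refine ⟨hf.1, fun x => (hf.2.1 x).trans h, fun g hg M hM N => (hf.2.2 g hg M hM N).trans ?_⟩
  have : 0 ≤ M := (norm_nonneg _).trans (hM 0)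
  gcongr

lemma const (c : ℂ) : WienerLE (fun _ => c) ‖c‖ := by
  refine ⟨continuous_const, fun _ => le_rfl, fun g hg M hM N => ?_⟩
  simp_rw [mul_assoc]
  rw [integral_const_mul, norm_mul]
  exact mul_le_mul_of_nonneg_left (hM N) (norm_nonneg _)

lemma char (K : ℤ) : WienerLE (unitChar K) 1 := by
  refine ⟨by fun_prop, fun x => (norm_unitChar K x).le, fun g hg M hM N => ?_⟩
  have h : ∀ x, unitChar K x * g x * unitChar N x = g x * unitChar (K + N) x := fun x => by
    rw [← unitChar_mul]; ring
  simp_rw [h, one_mul]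
  exact hM _

lemma add (hf : WienerLE f B) (hg : WienerLE g C) : WienerLE (fun x => f x + g x) (B + C) := by
  have hf1 := hf.1
  have hg1 := hg.1
  refine ⟨by fun_prop, fun x => (norm_add_le _ _).trans (add_le_add (hf.2.1 x) (hg.2.1 x)),
    fun h hh M hM N => ?_⟩
  simp_rw [add_mul]
  rw [integral_add (by apply Continuous.integrable_unitInterval; fun_prop)
    (by apply Continuous.integrable_unitInterval; fun_prop)]
  exact (norm_add_le _ _).trans (add_le_add (hf.2.2 h hh M hM N) (hg.2.2 h hh M hM N))

lemma mul (hf : WienerLE f B) (hg : WienerLE g C) : WienerLE (fun x => f x * g x) (B * C) := by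
  have hf1 := hf.1
  have hg1 := hg.1
  refine ⟨by fun_prop, fun x => ?_, fun h hh M hM N => ?_⟩
  · rw [norm_mul]
    exact mul_le_mul (hf.2.1 x) (hg.2.1 x) (norm_nonneg _) hf.nonneg
  · have := hf.2.2 (fun x => g x * h x) (by fun_prop) (C * M) (hg.2.2 h hh M hM) N
    simp_rw [mul_assoc] at this ⊢
    exact this

lemma const_mul (hf : WienerLE f B) (c : ℂ) : WienerLE (fun x => c * f x) (‖c‖ * B) :=
  (const c).mul hf

lemma pow (hf : WienerLE f B) (l : ℕ) : WienerLE (fun x => f x ^ l) (B ^ l) := by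
  induction l with
  | zero => simpa using const 1
  | succ l ih => simpa only [pow_succ] using ih.mul hf

lemma sum {ι : Type*} {s : Finset ι} {F : ι → unitInterval → ℂ} {B : ι → ℝ}
    (h : ∀ i ∈ s, WienerLE (F i) (B i)) :
    WienerLE (fun x => ∑ i ∈ s, F i x) (∑ i ∈ s, B i) := by
  classical
  induction s using Finset.induction_on with
  | empty => simpa using const 0
  | insert a s ha ih =>
    simp_rw [Finset.sum_insert ha]
    exact (h a (Finset.mem_insert_self a s)).add
      (ih fun i hi => h i (Finset.mem_insert_of_mem hi))

lemma cos (N : ℤ) : WienerLE (fun x => (unitCos N x : ℂ)) 1 := by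
  have h := ((char N).add (char (-N))).const_mul (1 / 2)
  have h2 : (fun x => 1 / 2 * (unitChar N x + unitChar (-N) x)) = fun x => (unitCos N x : ℂ) := by
    funext x
    rw [unitCos_eq]
    ring
  rw [h2] at h
  exact h.mono (by norm_num)

lemma hasSum {F : ℕ → unitInterval → ℂ} {B : ℕ → ℝ} (h : ∀ l, WienerLE (F l) (B l))
    (hB : HasSum B C) (hf : ∀ x, HasSum (fun l => F l x) (f x)) : WienerLE f C := by
  have hcont : Continuous f := by
    have h1 : f = fun x => ∑' l, F l x := funext fun x => (hf x).tsum_eq.symm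
    rw [h1]
    exact continuous_tsum (fun l => (h l).1) hB.summable fun l x => (h l).2.1 x
  refine ⟨hcont, fun x => ?_, fun g hg M hM N => ?_⟩
  · rw [← (hf x).tsum_eq]
    exact tsum_of_norm_bounded hB fun l => (h l).2.1 x
  · have hint : ∀ l, Integrable fun x => F l x * g x * unitChar N x := fun l => by
      have := (h l).1
      apply Continuous.integrable_unitInterval
      fun_prop
    obtain ⟨G, hG⟩ : ∃ G, ∀ x, ‖g x‖ ≤ G := by
      obtain ⟨G, hG⟩ := isCompact_univ.exists_bound_of_continuousOn hg.continuousOn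
      exact ⟨G, fun x => hG x trivial⟩
    have hnorm : ∀ l x, ‖F l x * g x * unitChar N x‖ ≤ B l * G := fun l x => by
      rw [norm_mul, norm_mul, norm_unitChar, mul_one]
      exact mul_le_mul ((h l).2.1 x) (hG x) (norm_nonneg _) (h l).nonneg
    have hsum : Summable fun l => ∫ x, ‖F l x * g x * unitChar N x‖ := by
      refine Summable.of_nonneg_of_le (fun l => integral_nonneg fun x => norm_nonneg _)
        (fun l => ?_) (hB.summable.mul_right G)
      calc ∫ x, ‖F l x * g x * unitChar N x‖ ≤ ∫ _ : unitInterval, B l * G :=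
            integral_mono (hint l).norm (integrable_const _) (hnorm l)
        _ = B l * G := by simp
    have h2 := hasSum_integral_of_summable_integral_norm hint hsum
    have h3 : ∀ x, ∑' l, F l x * g x * unitChar N x = f x * g x * unitChar N x := fun x =>
      (((hf x).mul_right _).mul_right _).tsum_eq
    simp_rw [h3] at h2
    rw [← h2.tsum_eq]
    exact tsum_of_norm_bounded (hB.mul_right M) fun l => (h l).2.2 g hg M hM N

/-- The part of order at least four of the logarithm in `exp z = (1 + z) exp (z - log (1 + z))`,
for the purely imaginary argument `z = i y cos (2 π N x)`. -/
lemma log_tail {y : ℝ} (hy : |y| ≤ 1 / 2) (N : ℤ) :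
    WienerLE (fun x => Complex.I * y * unitCos N x - (Complex.I * y * unitCos N x) ^ 2 / 2 +
      (Complex.I * y * unitCos N x) ^ 3 / 3 - Complex.log (1 + Complex.I * y * unitCos N x))
      (2 * |y| ^ 4) := by
  have hz : WienerLE (fun x => Complex.I * y * unitCos N x) |y| := by
    simpa using (cos N).const_mul (Complex.I * y)
  have hterm : ∀ l : ℕ, WienerLE (fun x => -((-1) ^ (l + 4 + 1) *
      (Complex.I * y * unitCos N x) ^ (l + 4) / ((l + 4 : ℕ) : ℂ))) (|y| ^ 4 * |y| ^ l) := by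
    intro l
    have h1 := (hz.pow (l + 4)).const_mul (-((-1) ^ (l + 4 + 1) / ((l + 4 : ℕ) : ℂ)))
    have h2 : (fun x => -((-1) ^ (l + 4 + 1) / ((l + 4 : ℕ) : ℂ)) *
        (Complex.I * y * unitCos N x) ^ (l + 4)) = fun x => -((-1) ^ (l + 4 + 1) *
        (Complex.I * y * unitCos N x) ^ (l + 4) / ((l + 4 : ℕ) : ℂ)) := by
      funext x; ring
    rw [h2] at h1
    refine h1.mono ?_
    rw [norm_neg, norm_div, norm_pow, norm_neg, norm_one, one_pow, Complex.norm_natCast,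
      pow_add |y| l 4, mul_comm (|y| ^ l)]
    refine mul_le_of_le_one_left (by positivity) ?_
    rw [div_le_one (by positivity)]
    push_cast
    have : (0 : ℝ) ≤ l := by positivity
    linarith
  have hgeom := (hasSum_geometric_of_lt_one (abs_nonneg y) (by linarith)).mul_left (|y| ^ 4)
  refine (hasSum hterm hgeom fun x => ?_).mono ?_
  · have hlt : ‖Complex.I * y * unitCos N x‖ < 1 := (hz.norm_le x).trans_lt (by linarith)
    have h1 := ((hasSum_nat_add_iff' 4).2 (Complex.hasSum_taylorSeries_log hlt)).neg
    have h2 : ∀ z l : ℂ, z - z ^ 2 / 2 + z ^ 3 / 3 - l =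
        -(l - ∑ i ∈ Finset.range 4, (-1) ^ (i + 1) * z ^ i / (i : ℂ)) := fun z l => by
      simp [Finset.sum_range_succ]
      ring
    rw [h2]
    exact h1
  · have h1 : (1 - |y|)⁻¹ ≤ 2 := by
      rw [inv_le_comm₀ (by linarith) (by norm_num)]
      linarith
    have : 0 ≤ |y| ^ 4 := by positivity
    nlinarith

end WienerLE

/-! ### Approximation by a Riesz product times a Taylor polynomial -/

/-- If `F = E₀ P exp Z` with `|F| = 1` and a constant `E₀`, and `Z` has an exponential moment of
order `t`, then `exp Z` can be replaced in the mean of `F` by its Taylor polynomial. -/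
lemma norm_integral_sub_taylor_le {F P Z : unitInterval → ℂ} {E₀ : ℂ} {t D : ℝ} (p : ℕ)
    (hF : Continuous F) (hP : Continuous P) (hZ : Continuous Z) (hF1 : ∀ x, ‖F x‖ = 1)
    (hFPZ : ∀ x, F x = P x * E₀ * Complex.exp (Z x)) (ht : 4 ≤ t)
    (hD : ∫ x, Real.exp (t * ‖Z x‖) ≤ D) :
    ‖(∫ x, F x) - E₀ * ∫ x, (∑ j ∈ Finset.range p, Z x ^ j / (j.factorial : ℂ)) * P x‖ ≤
      p.factorial * (2 / t) ^ p * D := by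
  have hpt : ∀ x, ‖F x - E₀ * ((∑ j ∈ Finset.range p, Z x ^ j / (j.factorial : ℂ)) * P x)‖ ≤
      p.factorial * (2 / t) ^ p * Real.exp (t * ‖Z x‖) := by
    intro x
    have h1 : F x - E₀ * ((∑ j ∈ Finset.range p, Z x ^ j / (j.factorial : ℂ)) * P x) =
        F x * Complex.exp (-Z x) *
          (Complex.exp (Z x) - ∑ j ∈ Finset.range p, Z x ^ j / (j.factorial : ℂ)) := by
      have : F x * Complex.exp (-Z x) = P x * E₀ := by
        rw [hFPZ, mul_assoc, ← Complex.exp_add, add_neg_cancel, Complex.exp_zero, mul_one]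
      rw [this, mul_sub, ← hFPZ]
      ring
    have h2 := Complex.norm_exp_sub_sum_le_norm_mul_exp (Z x) p
    have h3 : ‖Complex.exp (-Z x)‖ ≤ Real.exp ‖Z x‖ := by
      rw [Complex.norm_exp]
      exact Real.exp_le_exp.2 ((Complex.re_le_norm _).trans (norm_neg _).le)
    have h4 : ‖Z x‖ ^ p ≤ p.factorial * (2 / t) ^ p * Real.exp (t / 2 * ‖Z x‖) := by
      have h5 := Real.pow_div_factorial_le_exp (x := t / 2 * ‖Z x‖) (by positivity) p
      rw [div_le_iff₀ (by positivity), mul_pow] at h5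
      have h6 : (2 / t) ^ p * (t / 2) ^ p = 1 := by
        rw [← mul_pow, div_mul_div_comm, mul_comm, div_self (by positivity), one_pow]
      calc ‖Z x‖ ^ p = (2 / t) ^ p * ((t / 2) ^ p * ‖Z x‖ ^ p) := by rw [← mul_assoc, h6, one_mul]
        _ ≤ (2 / t) ^ p * (Real.exp (t / 2 * ‖Z x‖) * p.factorial) := by gcongr
        _ = _ := by ring
    rw [h1, norm_mul, norm_mul, hF1, one_mul]
    calc _ ≤ Real.exp ‖Z x‖ * (‖Z x‖ ^ p * Real.exp ‖Z x‖) := by gcongr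
      _ ≤ Real.exp ‖Z x‖ * (p.factorial * (2 / t) ^ p * Real.exp (t / 2 * ‖Z x‖) *
          Real.exp ‖Z x‖) := by gcongr
      _ = p.factorial * (2 / t) ^ p * Real.exp (‖Z x‖ + t / 2 * ‖Z x‖ + ‖Z x‖) := by
          rw [Real.exp_add, Real.exp_add]; ring
      _ ≤ _ := by
          gcongr
          nlinarith [norm_nonneg (Z x)]
  rw [← integral_const_mul, ← integral_sub (by apply Continuous.integrable_unitInterval; fun_prop)
    (by apply Continuous.integrable_unitInterval; fun_prop)]
  calc _ ≤ ∫ x, p.factorial * (2 / t) ^ p * Real.exp (t * ‖Z x‖) := by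
        refine norm_integral_le_of_norm_le ?_ (Eventually.of_forall hpt)
        apply Continuous.integrable_unitInterval
        fun_prop
    _ = p.factorial * (2 / t) ^ p * ∫ x, Real.exp (t * ‖Z x‖) := integral_const_mul _ _
    _ ≤ _ := by gcongr

lemma norm_integral_taylor_mul_le {P Z : unitInterval → ℂ} {B V : ℝ} (p : ℕ) (hP : Continuous P)
    (hPV : ∀ N, ‖∫ x, P x * unitChar N x‖ ≤ V) (hZ : WienerLE Z B) (hB : 1 ≤ B) :
    ‖∫ x, (∑ j ∈ Finset.range p, Z x ^ j / (j.factorial : ℂ)) * P x‖ ≤ p * B ^ p * V := by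
  have hV : 0 ≤ V := (norm_nonneg _).trans (hPV 0)
  have h1 : WienerLE (fun x => ∑ j ∈ Finset.range p, Z x ^ j / (j.factorial : ℂ))
      (∑ j ∈ Finset.range p, B ^ p) := by
    refine WienerLE.sum fun j hj => ?_
    have h2 := (hZ.pow j).const_mul (1 / (j.factorial : ℂ))
    have h3 : (fun x => 1 / (j.factorial : ℂ) * Z x ^ j) =
        fun x => Z x ^ j / (j.factorial : ℂ) := by funext x; ring
    rw [h3] at h2
    refine h2.mono ?_
    have h4 : ‖1 / (j.factorial : ℂ)‖ ≤ 1 := by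
      rw [norm_div, norm_one, Complex.norm_natCast, div_le_one (by positivity)]
      exact_mod_cast Nat.one_le_iff_ne_zero.2 j.factorial_ne_zero
    calc _ ≤ 1 * B ^ j := by gcongr
      _ ≤ B ^ p := by
        rw [one_mul]
        exact pow_le_pow_right₀ hB (Finset.mem_range.1 hj).le
  have h2 := h1.2.2 P hP V hPV 0
  simpa [unitChar] using h2

/-! ### The characteristic function of a lacunary sum -/

/-- The function `Z` in the factorization
`exp (i ∑ α_k cos θ_k) = ∏ (1 + i α_k cos θ_k) * exp (-¼ ∑ α_k²) * exp Z`, where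
`θ_k = 2 π m_k x`. The powers `cos² θ_k` and `cos³ θ_k` are written in terms of `cos 2θ_k`,
`cos θ_k` and `cos 3θ_k`; the last sum consists of the terms of order at least four. -/
noncomputable def expRemainder (α : ℕ → ℝ) (m : ℕ → ℤ) (n : ℕ) (x : unitInterval) : ℂ :=
  ∑ k ∈ Finset.Icc 1 n, (-(α k ^ 2 / 4 : ℂ) * unitCos (2 * m k) x +
    Complex.I * (α k ^ 3 / 4 : ℂ) * unitCos (m k) x +
    Complex.I * (α k ^ 3 / 12 : ℂ) * unitCos (3 * m k) x +
    (Complex.I * α k * unitCos (m k) x - (Complex.I * α k * unitCos (m k) x) ^ 2 / 2 +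
      (Complex.I * α k * unitCos (m k) x) ^ 3 / 3 -
      Complex.log (1 + Complex.I * α k * unitCos (m k) x)))

section Factorization

variable {α : ℕ → ℝ} {m : ℕ → ℤ} {n : ℕ} {q δ t : ℝ}

lemma wienerLE_expRemainder (hα : ∀ k ∈ Finset.Icc 1 n, |α k| ≤ δ) (hδ : δ ≤ 1 / 2) :
    WienerLE (expRemainder α m n) n := by
  have h : WienerLE (expRemainder α m n) (∑ k ∈ Finset.Icc 1 n, 1) := by
    refine WienerLE.sum fun k hk => ?_
    have hk' : |α k| ≤ 1 / 2 := (hα k hk).trans hδ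
    refine (((((WienerLE.cos (2 * m k)).const_mul (-(α k ^ 2 / 4 : ℂ))).add
      ((WienerLE.cos (m k)).const_mul (Complex.I * (α k ^ 3 / 4 : ℂ)))).add
      ((WienerLE.cos (3 * m k)).const_mul (Complex.I * (α k ^ 3 / 12 : ℂ)))).add
      (WienerLE.log_tail hk' (m k))).mono ?_
    simp only [norm_neg, norm_mul, norm_div, norm_pow, Complex.norm_I, Complex.norm_real,
      Real.norm_eq_abs, one_mul, mul_one]
    norm_num
    have h2 : |α k| ^ 2 ≤ (1 / 2) ^ 2 := by gcongr
    have h3 : |α k| ^ 3 ≤ (1 / 2) ^ 3 := by gcongr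
    have h4 : |α k| ^ 4 ≤ (1 / 2) ^ 4 := by gcongr
    rw [sq_abs] at h2
    linarith
  simpa using h

lemma unitCos_two_mul (N : ℤ) (x : unitInterval) :
    unitCos (2 * N) x = 2 * unitCos N x ^ 2 - 1 := by
  rw [unitCos, unitCos, ← Real.cos_two_mul]
  push_cast
  ring_nf

lemma unitCos_three_mul (N : ℤ) (x : unitInterval) :
    unitCos (3 * N) x = 4 * unitCos N x ^ 3 - 3 * unitCos N x := by
  rw [unitCos, unitCos, ← Real.cos_three_mul]
  push_cast
  ring_nf

lemma exp_sum_eq (hα : ∀ k ∈ Finset.Icc 1 n, |α k| ≤ δ) (hδ : δ ≤ 1 / 2) (x : unitInterval) :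
    Complex.exp (Complex.I * ((∑ k ∈ Finset.Icc 1 n, α k * unitCos (m k) x : ℝ) : ℂ)) =
      rieszProd (fun k => Complex.I * α k) m n x *
        ((Real.exp (-(1 / 4) * ∑ k ∈ Finset.Icc 1 n, α k ^ 2) : ℝ) : ℂ) *
        Complex.exp (expRemainder α m n x) := by
  rw [expRemainder, Complex.exp_sum, rieszProd, Complex.ofReal_exp]
  push_cast
  rw [Finset.mul_sum, Finset.mul_sum, Complex.exp_sum, Complex.exp_sum, ← Finset.prod_mul_distrib,
    ← Finset.prod_mul_distrib]
  refine Finset.prod_congr rfl fun k hk => ?_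
  have hlt : ‖Complex.I * α k * unitCos (m k) x‖ < 1 := by
    rw [norm_mul, norm_mul, Complex.norm_I, one_mul, Complex.norm_real, Complex.norm_real]
    have h1 := hα k hk
    have h2 := abs_unitCos_le (m k) x
    simp only [Real.norm_eq_abs]
    nlinarith [abs_nonneg (α k), abs_nonneg (unitCos (m k) x)]
  have hne : 1 + Complex.I * α k * unitCos (m k) x ≠ 0 := by
    intro h
    have h1 : Complex.I * α k * unitCos (m k) x = -1 := by linear_combination h
    rw [h1] at hlt
    simp at hlt
  nth_rewrite 1 [← Complex.exp_log hne]
  rw [← Complex.exp_add, ← Complex.exp_add, unitCos_two_mul, unitCos_three_mul]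
  congr 1
  push_cast
  linear_combination (α k ^ 2 * unitCos (m k) x ^ 2 / 2 : ℂ) * Complex.I_sq -
    Complex.I * (α k ^ 3 * unitCos (m k) x ^ 3 / 3 : ℂ) * Complex.I_sq

lemma norm_expRemainder_le (hα : ∀ k ∈ Finset.Icc 1 n, |α k| ≤ δ) (hδ : δ ≤ 1 / 2)
    (x : unitInterval) :
    ‖expRemainder α m n x‖ ≤ |∑ k ∈ Finset.Icc 1 n, α k ^ 2 / 4 * unitCos (2 * m k) x| +
      |∑ k ∈ Finset.Icc 1 n, α k ^ 3 / 4 * unitCos (m k) x| +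
      |∑ k ∈ Finset.Icc 1 n, α k ^ 3 / 12 * unitCos (3 * m k) x| + n * (2 * δ ^ 4) := by
  rw [expRemainder, Finset.sum_add_distrib, Finset.sum_add_distrib, Finset.sum_add_distrib]
  refine (norm_add_le _ _).trans (add_le_add ((norm_add_le _ _).trans (add_le_add
    ((norm_add_le _ _).trans (add_le_add (le_of_eq ?_) (le_of_eq ?_))) (le_of_eq ?_))) ?_)
  · rw [← Real.norm_eq_abs, ← Complex.norm_real, ← norm_neg]
    push_cast
    rw [← Finset.sum_neg_distrib]
    simp
  · rw [← Real.norm_eq_abs, ← Complex.norm_real]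
    push_cast
    simp_rw [mul_assoc, ← Finset.mul_sum]
    simp
  · rw [← Real.norm_eq_abs, ← Complex.norm_real]
    push_cast
    simp_rw [mul_assoc, ← Finset.mul_sum]
    simp
  · calc _ ≤ ∑ k ∈ Finset.Icc 1 n, 2 * δ ^ 4 := by
          refine norm_sum_le_of_le _ fun k hk => ?_
          refine ((WienerLE.log_tail ((hα k hk).trans hδ) (m k)).norm_le x).trans ?_
          have := hα k hk
          gcongr
      _ = n * (2 * δ ^ 4) := by simp

lemma exp_add_three_le (a b c : ℝ) :
    Real.exp (a + b + c) ≤ Real.exp (3 * a) + Real.exp (3 * b) + Real.exp (3 * c) := by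
  have ha := Real.exp_pos (3 * a)
  have hb := Real.exp_pos (3 * b)
  have hc := Real.exp_pos (3 * c)
  rcases le_total a b with h1 | h1 <;> rcases le_total b c with h2 | h2 <;>
    rcases le_total a c with h3 | h3
  all_goals first
    | (have : Real.exp (a + b + c) ≤ Real.exp (3 * a) := Real.exp_le_exp.2 (by linarith)
       linarith)
    | (have : Real.exp (a + b + c) ≤ Real.exp (3 * b) := Real.exp_le_exp.2 (by linarith)
       linarith)
    | (have : Real.exp (a + b + c) ≤ Real.exp (3 * c) := Real.exp_le_exp.2 (by linarith)
       linarith)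

/-- The three cosine sums in `expRemainder` have exponential moments of the large order `t`, by
comparison with Riesz products of weights at most `t δ²`. -/
lemma integral_exp_expRemainder_le {C : ℝ}
    (hC : ∀ (m : ℕ → ℤ), IsLacunary m q → ∀ (w : ℕ → ℂ) (n : ℕ) (η : ℝ), 0 ≤ η →
      (∀ k ∈ Finset.Icc 1 n, ‖w k‖ ≤ η) → C * η ≤ 1 → (q ≤ 2 → C * (n * η ^ 3) ≤ 1) →
      (∀ N, ‖rieszCoeff w m n N‖ ≤ 2))
    (hm : IsLacunary m q) (hα : ∀ k ∈ Finset.Icc 1 n, |α k| ≤ δ) (hδ0 : 0 ≤ δ) (hδ : δ ≤ 1 / 2)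
    (ht : 4 ≤ t) (h5 : 5 * (t * δ ^ 2) ≤ 1) (hCt : C * (t * δ ^ 2) ≤ 1)
    (hn : n * (t * δ ^ 2) ^ 2 ≤ 1) :
    ∫ x, Real.exp (t * ‖expRemainder α m n x‖) ≤ 12 * Real.exp 4 := by
  obtain ⟨η, hη⟩ : ∃ η, η = t * δ ^ 2 := ⟨_, rfl⟩
  rw [← hη] at h5 hCt hn
  have hη0 : 0 ≤ η := by rw [hη]; positivity
  have hn0 : (0 : ℝ) ≤ n := by positivity
  have hcoeff : ∀ (m : ℕ → ℤ), IsLacunary m q → ∀ w : ℕ → ℂ,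
      (∀ k ∈ Finset.Icc 1 n, ‖w k‖ ≤ η) → ‖rieszCoeff w m n 0‖ ≤ 2 := fun m hm w hw => by
    refine hC m hm w n η hη0 hw hCt (fun _ => ?_) 0
    calc C * (n * η ^ 3) = C * η * (n * η ^ 2) := by ring
      _ ≤ 1 * (n * η ^ 2) := by gcongr
      _ ≤ 1 := by linarith
  have moment : ∀ (m : ℕ → ℤ), IsLacunary m q → ∀ b : ℕ → ℝ,
      (∀ k ∈ Finset.Icc 1 n, |b k| ≤ η) →
      ∫ x, Real.exp |∑ k ∈ Finset.Icc 1 n, b k * unitCos (m k) x| ≤ 4 * Real.exp 2 := by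
    intro m hm b hb
    have hsq : ∑ k ∈ Finset.Icc 1 n, b k ^ 2 ≤ 1 := by
      calc ∑ k ∈ Finset.Icc 1 n, b k ^ 2 ≤ ∑ k ∈ Finset.Icc 1 n, η ^ 2 := by
            refine Finset.sum_le_sum fun k hk => sq_le_sq' ?_ ?_
            · linarith [(abs_le.1 (hb k hk)).1]
            · exact (abs_le.1 (hb k hk)).2
        _ = n * η ^ 2 := by simp
        _ ≤ 1 := hn
    refine (integral_exp_abs_sum_le (V := 2) (fun k hk => (hb k hk).trans (by linarith))
      (hcoeff m hm _ fun k hk => ?_) (hcoeff m hm _ fun k hk => ?_)).trans ?_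
    · simpa using hb k hk
    · simpa using hb k hk
    · have : Real.exp (2 * ∑ k ∈ Finset.Icc 1 n, b k ^ 2) ≤ Real.exp 2 :=
        Real.exp_le_exp.2 (by linarith)
      linarith
  have hδ3 : δ ^ 3 ≤ δ ^ 2 := pow_le_pow_of_le_one hδ0 (by linarith) (by norm_num)
  have hb1 : ∀ k ∈ Finset.Icc 1 n, |3 * t * (α k ^ 2 / 4)| ≤ η := fun k hk => by
    have h1 : |α k| ^ 2 ≤ δ ^ 2 := by have := hα k hk; gcongr
    rw [abs_mul, abs_mul, abs_div, abs_pow, abs_of_nonneg (show 0 ≤ t by linarith), hη]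
    norm_num
    rw [sq_abs] at h1
    nlinarith
  have hb2 : ∀ k ∈ Finset.Icc 1 n, |3 * t * (α k ^ 3 / 4)| ≤ η := fun k hk => by
    have h1 : |α k| ^ 3 ≤ δ ^ 3 := by have := hα k hk; gcongr
    rw [abs_mul, abs_mul, abs_div, abs_pow, abs_of_nonneg (show 0 ≤ t by linarith), hη]
    norm_num
    nlinarith
  have hb3 : ∀ k ∈ Finset.Icc 1 n, |3 * t * (α k ^ 3 / 12)| ≤ η := fun k hk => by
    have h1 : |α k| ^ 3 ≤ δ ^ 3 := by have := hα k hk; gcongr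
    rw [abs_mul, abs_mul, abs_div, abs_pow, abs_of_nonneg (show 0 ≤ t by linarith), hη]
    norm_num
    nlinarith
  have m1 := moment _ (hm.const_mul (c := 2) (by norm_num)) _ hb1
  have m2 := moment _ hm _ hb2
  have m3 := moment _ (hm.const_mul (c := 3) (by norm_num)) _ hb3
  have hpt : ∀ x, Real.exp (t * ‖expRemainder α m n x‖) ≤ Real.exp 2 *
      (Real.exp |∑ k ∈ Finset.Icc 1 n, 3 * t * (α k ^ 2 / 4) * unitCos (2 * m k) x| +
        Real.exp |∑ k ∈ Finset.Icc 1 n, 3 * t * (α k ^ 3 / 4) * unitCos (m k) x| +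
        Real.exp |∑ k ∈ Finset.Icc 1 n, 3 * t * (α k ^ 3 / 12) * unitCos (3 * m k) x|) := by
    intro x
    have h1 := norm_expRemainder_le (m := m) hα hδ x
    have h2 : t * (n * (2 * δ ^ 4)) ≤ 2 := by
      have h3 : t * (n * δ ^ 4) ≤ t ^ 2 * (n * δ ^ 4) := by
        have h4 : 0 ≤ n * δ ^ 4 := by positivity
        exact mul_le_mul_of_nonneg_right (by nlinarith) h4
      have h4 : n * η ^ 2 = t ^ 2 * (n * δ ^ 4) := by rw [hη]; ring
      linarith
    have pull : ∀ (β : ℕ → ℝ) (M : ℕ → ℤ), |∑ k ∈ Finset.Icc 1 n, 3 * t * β k * unitCos (M k) x| =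
        3 * (t * |∑ k ∈ Finset.Icc 1 n, β k * unitCos (M k) x|) := fun β M => by
      simp_rw [mul_assoc, ← Finset.mul_sum]
      rw [abs_mul, abs_mul, abs_of_nonneg (show 0 ≤ t by linarith)]
      norm_num
    rw [pull (fun k => α k ^ 2 / 4) (fun k => 2 * m k), pull (fun k => α k ^ 3 / 4) m,
      pull (fun k => α k ^ 3 / 12) (fun k => 3 * m k)]
    refine le_trans ?_ (mul_le_mul_of_nonneg_left (exp_add_three_le _ _ _) (Real.exp_pos 2).le)
    rw [← Real.exp_add]
    refine Real.exp_le_exp.2 ?_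
    have := mul_le_mul_of_nonneg_left h1 (show 0 ≤ t by linarith)
    linarith
  have hcont := (wienerLE_expRemainder (m := m) hα hδ).continuous
  calc _ ≤ ∫ x, Real.exp 2 *
      (Real.exp |∑ k ∈ Finset.Icc 1 n, 3 * t * (α k ^ 2 / 4) * unitCos (2 * m k) x| +
        Real.exp |∑ k ∈ Finset.Icc 1 n, 3 * t * (α k ^ 3 / 4) * unitCos (m k) x| +
        Real.exp |∑ k ∈ Finset.Icc 1 n, 3 * t * (α k ^ 3 / 12) * unitCos (3 * m k) x|) := by
        refine integral_mono ?_ ?_ hpt <;> apply Continuous.integrable_unitInterval <;> fun_prop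
    _ ≤ Real.exp 2 * (4 * Real.exp 2 + 4 * Real.exp 2 + 4 * Real.exp 2) := by
        rw [integral_const_mul, integral_add, integral_add]
        · gcongr
        all_goals
          apply Continuous.integrable_unitInterval
          fun_prop
    _ = 12 * Real.exp 4 := by
        rw [show (4 : ℝ) = 2 + 2 by norm_num, Real.exp_add]
        ring

end Factorization

/-- Estimates for the characteristic function of a lacunary cosine sum with small coefficients
`|α_k| ≤ δ`: a Gaussian approximation with an error of order `1 / t`, and an upper bound with an
error of order `t ^ (-p)` for any `p`, at the cost of a polynomial factor in the Gaussian term. -/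
theorem exists_norm_charFun_le {q : ℝ} (hq : 1 < q) :
    ∃ C : ℝ, 0 < C ∧ ∀ (m : ℕ → ℤ), IsLacunary m q → ∀ (α : ℕ → ℝ) (n : ℕ) (δ t : ℝ), 1 ≤ n →
      (∀ k ∈ Finset.Icc 1 n, |α k| ≤ δ) → 0 ≤ δ → C * δ ≤ 1 → (q ≤ 2 → C * (n * δ ^ 3) ≤ 1) →
      4 ≤ t → C * (t * δ ^ 2) ≤ 1 → n * (t * δ ^ 2) ^ 2 ≤ 1 →
      ‖(∫ x, Complex.exp (Complex.I *
          ((∑ k ∈ Finset.Icc 1 n, α k * unitCos (m k) x : ℝ) : ℂ))) -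
        ((Real.exp (-(1 / 4) * ∑ k ∈ Finset.Icc 1 n, α k ^ 2) : ℝ) : ℂ)‖ ≤
          (if q ≤ 2 then C * (n * δ ^ 3) else 0) + C / t ∧
      ‖∫ x, Complex.exp (Complex.I *
          ((∑ k ∈ Finset.Icc 1 n, α k * unitCos (m k) x : ℝ) : ℂ))‖ ≤
        2 * Real.exp (-(1 / 4) * ∑ k ∈ Finset.Icc 1 n, α k ^ 2) + C / t ∧
      ∀ p : ℕ, ‖∫ x, Complex.exp (Complex.I *
          ((∑ k ∈ Finset.Icc 1 n, α k * unitCos (m k) x : ℝ) : ℂ))‖ ≤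
        2 * p * n ^ p * Real.exp (-(1 / 4) * ∑ k ∈ Finset.Icc 1 n, α k ^ 2) +
          C * p.factorial * (2 / t) ^ p := by
  obtain ⟨C₀, hC₀, hC⟩ := exists_norm_rieszCoeff_le hq
  have h24 : 0 < 24 * Real.exp 4 := by positivity
  refine ⟨C₀ + 5 + 24 * Real.exp 4, by positivity, ?_⟩
  intro m hm α n δ t hn hα hδ0 hCδ hCn ht hCt hnt
  have hη0 : 0 ≤ t * δ ^ 2 := by positivity
  have hnδ : 0 ≤ n * δ ^ 3 := by positivity
  have hδ : δ ≤ 1 / 2 := by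
    nlinarith [mul_nonneg hC₀.le hδ0, mul_nonneg h24.le hδ0]
  have h0δ : C₀ * δ ≤ 1 := by nlinarith [mul_nonneg h24.le hδ0]
  have h0n : q ≤ 2 → C₀ * (n * δ ^ 3) ≤ 1 := fun h => by
    nlinarith [hCn h, mul_nonneg h24.le hnδ]
  have h0t : C₀ * (t * δ ^ 2) ≤ 1 := by nlinarith [mul_nonneg h24.le hη0]
  have h5t : 5 * (t * δ ^ 2) ≤ 1 := by
    nlinarith [mul_nonneg h24.le hη0, mul_nonneg hC₀.le hη0]
  have hw : ∀ k ∈ Finset.Icc 1 n, ‖Complex.I * (α k : ℂ)‖ ≤ δ := fun k hk => by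
    simpa using hα k hk
  obtain ⟨hV, hV0⟩ := hC m hm (fun k => Complex.I * α k) n δ hδ0 hw h0δ h0n
  have hmom := integral_exp_expRemainder_le
    (fun m hm w n η h1 h2 h3 h4 => (hC m hm w n η h1 h2 h3 h4).1) hm hα hδ0 hδ ht h5t h0t hnt
  have hW := wienerLE_expRemainder (m := m) hα hδ
  set E₀ : ℝ := Real.exp (-(1 / 4) * ∑ k ∈ Finset.Icc 1 n, α k ^ 2) with hE₀
  have hE₀0 : 0 < E₀ := Real.exp_pos _
  have hE₀1 : E₀ ≤ 1 := by
    rw [hE₀, Real.exp_le_one_iff]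
    have : 0 ≤ ∑ k ∈ Finset.Icc 1 n, α k ^ 2 := Finset.sum_nonneg fun _ _ => sq_nonneg _
    linarith
  have hE₀n : ‖(E₀ : ℂ)‖ = E₀ := by
    rw [Complex.norm_real, Real.norm_eq_abs, abs_of_pos hE₀0]
  have htaylor := fun p => norm_integral_sub_taylor_le
    (F := fun x => Complex.exp (Complex.I *
      ((∑ k ∈ Finset.Icc 1 n, α k * unitCos (m k) x : ℝ) : ℂ)))
    (P := rieszProd (fun k => Complex.I * α k) m n) p
    (by fun_prop) (by fun_prop) hW.continuous
    (fun x => by rw [mul_comm]; exact Complex.norm_exp_ofReal_mul_I _) (exp_sum_eq hα hδ) ht hmom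
  have hfirst := htaylor 1
  simp only [Finset.sum_range_one, pow_zero, Nat.factorial_zero, Nat.cast_one, div_one, one_mul,
    Nat.factorial_one, pow_one, integral_rieszProd] at hfirst
  have hD : 2 / t * (12 * Real.exp 4) ≤ (C₀ + 5 + 24 * Real.exp 4) / t := by
    rw [div_mul_eq_mul_div]
    gcongr
    linarith
  refine ⟨?_, ?_, fun p => ?_⟩
  · calc _ = ‖_‖ := congrArg norm (sub_add_sub_cancel _
          ((E₀ : ℂ) * rieszCoeff (fun k => Complex.I * α k) m n 0) _).symm
      _ ≤ _ := norm_add_le _ _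
      _ ≤ (C₀ + 5 + 24 * Real.exp 4) / t +
          if q ≤ 2 then (C₀ + 5 + 24 * Real.exp 4) * (n * δ ^ 3) else 0 := by
        refine add_le_add (hfirst.trans hD) ?_
        have h1 : (E₀ : ℂ) * rieszCoeff (fun k => Complex.I * α k) m n 0 - E₀ =
            E₀ * (rieszCoeff (fun k => Complex.I * α k) m n 0 - 1) := by ring
        rw [h1, norm_mul, hE₀n]
        refine (mul_le_of_le_one_left (norm_nonneg _) hE₀1).trans (hV0.trans ?_)
        split_ifs
        · gcongr
          linarith
        · exact le_rfl
      _ = _ := add_comm _ _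
  · have h1 := norm_le_norm_sub_add _ _ |>.trans (add_le_add_left (hfirst.trans hD)
      ‖(E₀ : ℂ) * rieszCoeff (fun k => Complex.I * α k) m n 0‖)
    refine h1.trans ?_
    rw [norm_mul, hE₀n]
    nlinarith [hV 0]
  · have h2 := norm_integral_taylor_mul_le p (continuous_rieszProd (fun k => Complex.I * α k) m n)
      (V := 2) (fun N => by rw [integral_rieszProd_mul_unitChar]; exact hV N) hW
      (by exact_mod_cast hn)
    have h1 := norm_le_norm_sub_add _ _ |>.trans (add_le_add_left (htaylor p)
      ‖(E₀ : ℂ) * ∫ x, (∑ j ∈ Finset.range p, expRemainder α m n x ^ j / (j.factorial : ℂ)) *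
        rieszProd (fun k => Complex.I * α k) m n x‖)
    refine h1.trans ?_
    rw [norm_mul, hE₀n]
    have h3 := mul_le_mul_of_nonneg_left h2 hE₀0.le
    have h4 : p.factorial * (2 / t) ^ p * (12 * Real.exp 4) ≤
        (C₀ + 5 + 24 * Real.exp 4) * p.factorial * (2 / t) ^ p := by
      have : 0 ≤ p.factorial * (2 / t) ^ p := by positivity
      nlinarith
    linarith

/-! ### Uniform integrability and tightness -/

/-- Dominated convergence up to an error that is small in `L¹`. -/
lemma tendsto_eLpNorm_sub_of_dominated_add {X : Type*} [MeasurableSpace X] {μ : Measure X}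
    {f : ℕ → X → ℂ} {g : X → ℂ} {G : X → ℝ} {H : ℕ → X → ℝ}
    (hf : ∀ n, AEStronglyMeasurable (f n) μ) (hg : AEStronglyMeasurable g μ)
    (hlim : ∀ᵐ x ∂μ, Tendsto (fun n => f n x) atTop (𝓝 (g x))) (hG : Integrable G μ)
    (hgG : ∀ x, ‖g x‖ ≤ G x) (hH : ∀ n, Integrable (H n) μ) (hH0 : ∀ n x, 0 ≤ H n x)
    (hfGH : ∀ᶠ n in atTop, ∀ x, ‖f n x‖ ≤ G x + H n x)
    (hHlim : Tendsto (fun n => ∫ x, H n x ∂μ) atTop (𝓝 0)) :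
    Tendsto (fun n => eLpNorm (f n - g) 1 μ) atTop (𝓝 0) := by
  have hmeas : ∀ n, AEStronglyMeasurable (fun x => min ‖f n x - g x‖ (2 * G x)) μ := fun n =>
    (((hf n).sub hg).norm).inf (hG.1.const_mul 2)
  have h1 : Tendsto (fun n => ∫⁻ x, ENNReal.ofReal (min ‖f n x - g x‖ (2 * G x)) ∂μ) atTop
      (𝓝 (∫⁻ _, 0 ∂μ)) := by
    refine tendsto_lintegral_of_dominated_convergence' (fun x => ENNReal.ofReal (2 * G x))
      (fun n => (hmeas n).aemeasurable.ennreal_ofReal)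
      (fun n => Eventually.of_forall fun x => ENNReal.ofReal_le_ofReal (min_le_right _ _))
      (hG.const_mul 2).lintegral_lt_top.ne ?_
    filter_upwards [hlim] with x hx
    have hG0 : 0 ≤ 2 * G x := by linarith [(norm_nonneg _).trans (hgG x)]
    have h2 : Tendsto (fun n => ‖f n x - g x‖) atTop (𝓝 0) := by
      simpa using (hx.sub_const (g x)).norm
    have h3 := h2.min (tendsto_const_nhds (x := 2 * G x))
    rw [min_eq_left hG0] at h3
    simpa using ENNReal.tendsto_ofReal h3
  rw [lintegral_zero] at h1
  have h2 : Tendsto (fun n => ENNReal.ofReal (∫ x, H n x ∂μ)) atTop (𝓝 0) := by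
    simpa using ENNReal.tendsto_ofReal hHlim
  have h3 := h1.add h2
  rw [add_zero] at h3
  refine tendsto_of_tendsto_of_tendsto_of_le_of_le' tendsto_const_nhds h3
    (Eventually.of_forall fun _ => bot_le) ?_
  filter_upwards [hfGH] with n hn
  rw [eLpNorm_one_eq_lintegral_enorm, ofReal_integral_eq_lintegral_ofReal (hH n)
    (Eventually.of_forall (hH0 n)), ← lintegral_add_left' (hmeas n).aemeasurable.ennreal_ofReal]
  refine lintegral_mono fun x => ?_
  have hG0 : 0 ≤ G x := (norm_nonneg _).trans (hgG x)
  rw [← ENNReal.ofReal_add (le_min (norm_nonneg _) (by linarith)) (hH0 n x), Pi.sub_apply,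
    ← ofReal_norm]
  refine ENNReal.ofReal_le_ofReal ?_
  have h4 : ‖f n x - g x‖ ≤ 2 * G x + H n x := by
    linarith [norm_sub_le (f n x) (g x), hn x, hgG x]
  rcases min_cases ‖f n x - g x‖ (2 * G x) with h | h
  · linarith [hH0 n x]
  · linarith

/-- A sequence that converges in `L¹` is uniformly integrable and tight. -/
lemma uniformIntegrable_and_unifTight_of_tendsto {X : Type*} [MeasurableSpace X] {μ : Measure X}
    {f : ℕ → X → ℂ} {g : X → ℂ} (hf : ∀ n, MemLp (f n) 1 μ) (hg : MemLp g 1 μ)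
    (h : Tendsto (fun n => eLpNorm (f n - g) 1 μ) atTop (𝓝 0)) :
    UniformIntegrable f 1 μ ∧ UnifTight f 1 μ := by
  obtain ⟨-, h1, h2⟩ := (tendstoInMeasure_iff_tendsto_Lp le_rfl ENNReal.one_ne_top hf hg).2 h
  refine ⟨⟨fun n => (hf n).1, h1, ?_⟩, h2⟩
  obtain ⟨D, hD⟩ := ((ENNReal.tendsto_toNNReal ENNReal.zero_ne_top).comp h).bddAbove_range
  refine ⟨D + (eLpNorm g 1 μ).toNNReal, fun n => ?_⟩
  have hfin : eLpNorm (f n - g) 1 μ ≠ ⊤ := ((hf n).sub hg).2.ne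
  have h3 : eLpNorm (f n - g) 1 μ ≤ D := by
    rw [← ENNReal.coe_toNNReal hfin]
    exact ENNReal.coe_le_coe.2 (hD ⟨n, rfl⟩)
  calc eLpNorm (f n) 1 μ = eLpNorm ((f n - g) + g) 1 μ := by rw [sub_add_cancel]
    _ ≤ eLpNorm (f n - g) 1 μ + eLpNorm g 1 μ :=
      eLpNorm_add_le ((hf n).1.sub hg.1) hg.1 le_rfl
    _ ≤ _ := by
      rw [ENNReal.coe_add, ENNReal.coe_toNNReal hg.2.ne]
      gcongr

/-! ### Size of the coefficients -/

lemma abs_le_maxCoeff (a : ℕ → ℕ → ℝ) {n k : ℕ} (hk : k ∈ Finset.Icc 1 n) :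
    |a k n| ≤ maxCoeff a n := by
  have h := Finset.le_sup (f := fun k => ‖a k n‖₊) hk
  have h2 : ((‖a k n‖₊ : NNReal) : ℝ) ≤ maxCoeff a n := by
    unfold maxCoeff
    exact_mod_cast h
  simpa using h2

lemma maxCoeff_nonneg (a : ℕ → ℕ → ℝ) (n : ℕ) : 0 ≤ maxCoeff a n := NNReal.coe_nonneg _

lemma trigScale_nonneg (a : ℕ → ℕ → ℝ) (n : ℕ) : 0 ≤ trigScale a n := Real.sqrt_nonneg _

lemma trigScale_sq (a : ℕ → ℕ → ℝ) (n : ℕ) :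
    trigScale a n ^ 2 = (1 / 2) * ∑ k ∈ Finset.Icc 1 n, a k n ^ 2 :=
  Real.sq_sqrt (mul_nonneg (by norm_num) (Finset.sum_nonneg fun _ _ => sq_nonneg _))

lemma trigScale_le (a : ℕ → ℕ → ℝ) {n : ℕ} (hd : maxCoeff a n ≤ 1) : trigScale a n ≤ n := by
  rcases Nat.eq_zero_or_pos n with rfl | hn
  · simp [trigScale]
  have hn' : (1 : ℝ) ≤ n := by exact_mod_cast hn
  have h1 : ∑ k ∈ Finset.Icc 1 n, a k n ^ 2 ≤ ∑ k ∈ Finset.Icc 1 n, 1 := by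
    refine Finset.sum_le_sum fun k hk => ?_
    rw [← sq_abs]
    exact pow_le_one₀ (abs_nonneg _) ((abs_le_maxCoeff a hk).trans hd)
  refine Real.sqrt_le_iff.2 ⟨by positivity, ?_⟩
  simp at h1
  nlinarith

lemma tendsto_zero_of_pow {u : ℕ → ℝ} {r : ℕ} (hr : r ≠ 0) (hu : ∀ n, 0 ≤ u n)
    (h : Tendsto (fun n => u n ^ r) atTop (𝓝 0)) : Tendsto u atTop (𝓝 0) := by
  have hr' : (0 : ℝ) < 1 / r := by positivity
  have h2 := h.rpow_const (p := (1 / r : ℝ)) (Or.inr hr'.le)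
  rw [Real.zero_rpow hr'.ne'] at h2
  refine h2.congr fun n => ?_
  rw [one_div]
  exact Real.pow_rpow_inv_natCast (hu n) hr

/-- The hypothesis on the coefficients in the form in which it is used; `n ^ τ` is the order of the
exponential moments. -/
lemma exists_tendsto_maxCoeff {a : ℕ → ℕ → ℝ} {q : ℝ}
    (hd : ∃ ε : ℝ, 0 < ε ∧
      (q ≤ 2 → Tendsto (fun n : ℕ => (n : ℝ) ^ (1 + ε) * maxCoeff a n ^ 3) atTop (𝓝 0)) ∧
      (2 < q → Tendsto (fun n : ℕ => (n : ℝ) ^ (1 + ε) * maxCoeff a n ^ 4) atTop (𝓝 0))) :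
    ∃ τ : ℝ, 0 < τ ∧ Tendsto (maxCoeff a) atTop (𝓝 0) ∧
      Tendsto (fun n : ℕ => (n : ℝ) ^ τ * maxCoeff a n ^ 2) atTop (𝓝 0) ∧
      Tendsto (fun n : ℕ => n * ((n : ℝ) ^ τ * maxCoeff a n ^ 2) ^ 2) atTop (𝓝 0) ∧
      (q ≤ 2 → Tendsto (fun n : ℕ => n * maxCoeff a n ^ 3) atTop (𝓝 0)) := by
  obtain ⟨ε, hε, h3, h4⟩ := hd
  have hd0 := maxCoeff_nonneg a
  have hpow : ∀ {n : ℕ}, 1 ≤ n → (1 : ℝ) ≤ (n : ℝ) ^ (1 + ε) := fun {n} hn =>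
    Real.one_le_rpow (by exact_mod_cast hn) (by linarith)
  have hdrop : ∀ r : ℕ, r ≠ 0 →
      Tendsto (fun n : ℕ => (n : ℝ) ^ (1 + ε) * maxCoeff a n ^ r) atTop (𝓝 0) →
      Tendsto (maxCoeff a) atTop (𝓝 0) := by
    intro r hr h
    refine tendsto_zero_of_pow hr hd0 (squeeze_zero' (Eventually.of_forall fun n =>
      pow_nonneg (hd0 n) r) ?_ h)
    filter_upwards [eventually_ge_atTop 1] with n hn
    exact le_mul_of_one_le_left (pow_nonneg (hd0 n) r) (hpow hn)
  have hboth : Tendsto (maxCoeff a) atTop (𝓝 0) ∧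
      Tendsto (fun n : ℕ => (n : ℝ) ^ (1 + ε) * maxCoeff a n ^ 4) atTop (𝓝 0) := by
    rcases le_or_gt q 2 with hq | hq
    · have h := hdrop 3 (by norm_num) (h3 hq)
      refine ⟨h, ?_⟩
      have h5 := (h3 hq).mul h
      rw [mul_zero] at h5
      refine h5.congr fun n => by ring
    · exact ⟨hdrop 4 (by norm_num) (h4 hq), h4 hq⟩
  have hsq : Tendsto (fun n : ℕ => n * ((n : ℝ) ^ (ε / 2) * maxCoeff a n ^ 2) ^ 2) atTop
      (𝓝 0) := by
    refine hboth.2.congr' ?_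
    filter_upwards [eventually_ge_atTop 1] with n hn
    have hn' : (0 : ℝ) < n := by exact_mod_cast hn
    rw [Real.rpow_add hn', Real.rpow_one, mul_pow, ← Real.rpow_mul_natCast hn'.le]
    push_cast
    rw [div_mul_cancel₀ ε (by norm_num : (2 : ℝ) ≠ 0)]
    ring
  refine ⟨ε / 2, by linarith, hboth.1, ?_, hsq, fun hq => ?_⟩
  · refine tendsto_zero_of_pow (r := 2) (by norm_num) (fun n => ?_) (squeeze_zero'
      (Eventually.of_forall fun n => sq_nonneg _) ?_ hsq)
    · exact mul_nonneg (Real.rpow_nonneg (Nat.cast_nonneg n) _) (sq_nonneg _)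
    filter_upwards [eventually_ge_atTop 1] with n hn
    exact le_mul_of_one_le_left (sq_nonneg _) (by exact_mod_cast hn)
  · refine squeeze_zero' (Eventually.of_forall fun n =>
      mul_nonneg (Nat.cast_nonneg n) (pow_nonneg (hd0 n) 3)) ?_ (h3 hq)
    filter_upwards [eventually_ge_atTop 1] with n hn
    have hn' : (1 : ℝ) ≤ n := by exact_mod_cast hn
    refine mul_le_mul_of_nonneg_right ?_ (pow_nonneg (hd0 n) 3)
    exact Real.self_le_rpow_of_one_le hn' (by linarith)

/-! ### Mod-Gaussian convergence -/

section ModGaussian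

variable {a : ℕ → ℕ → ℝ} {m : ℕ → ℤ} {q τ : ℝ}

lemma continuous_trigSum (a : ℕ → ℕ → ℝ) (m : ℕ → ℤ) (n : ℕ) : Continuous (trigSum a m n) := by
  unfold trigSum; fun_prop

lemma complexMGF_trigSum_eq (a : ℕ → ℕ → ℝ) (m : ℕ → ℤ) (n : ℕ) (t A : ℝ) :
    complexMGF (trigSum a m n) volume (Complex.I * (t : ℂ) / (A : ℂ)) =
      ∫ x, Complex.exp (Complex.I *
        ((∑ k ∈ Finset.Icc 1 n, t / A * a k n * unitCos (m k) x : ℝ) : ℂ)) := by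
  rw [complexMGF]
  congr 1
  funext x
  congr 1
  simp_rw [mul_assoc, ← Finset.mul_sum]
  rw [trigSum]
  simp_rw [unitCos]
  push_cast
  ring

lemma complexMGF_trigSum_eq_charFun (a : ℕ → ℕ → ℝ) (m : ℕ → ℤ) (n : ℕ) (t A : ℝ) :
    complexMGF (trigSum a m n) volume (Complex.I * (t : ℂ) / (A : ℂ)) =
      charFun ((volume : Measure unitInterval).map (trigSum a m n)) (t / A) := by
  rw [← complexMGF_mul_I (continuous_trigSum a m n).aemeasurable]
  congr 1
  push_cast
  ring

/-- The estimates of `exists_norm_charFun_le` hold for all large `n`, uniformly in `|t| ≤ A_n K`. -/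
lemma exists_eventually_norm_complexMGF_le (hm : IsLacunary m q)
    (hA : Tendsto (trigScale a) atTop atTop) (hτ : 0 < τ)
    (hd : Tendsto (maxCoeff a) atTop (𝓝 0))
    (hd2 : Tendsto (fun n : ℕ => (n : ℝ) ^ τ * maxCoeff a n ^ 2) atTop (𝓝 0))
    (hd4 : Tendsto (fun n : ℕ => n * ((n : ℝ) ^ τ * maxCoeff a n ^ 2) ^ 2) atTop (𝓝 0))
    (hd3 : q ≤ 2 → Tendsto (fun n : ℕ => n * maxCoeff a n ^ 3) atTop (𝓝 0)) :
    ∃ C : ℝ, 0 < C ∧ ∀ K : ℝ, 0 ≤ K → ∀ᶠ n : ℕ in atTop, ∀ t : ℝ, |t| ≤ trigScale a n * K →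
      ‖complexMGF (trigSum a m n) volume (Complex.I * (t : ℂ) / (trigScale a n : ℂ)) -
          ((Real.exp (-t ^ 2 / 2) : ℝ) : ℂ)‖ ≤
        (if q ≤ 2 then C * (n * (K * maxCoeff a n) ^ 3) else 0) + C / (n : ℝ) ^ τ ∧
      ‖complexMGF (trigSum a m n) volume (Complex.I * (t : ℂ) / (trigScale a n : ℂ))‖ ≤
        2 * Real.exp (-t ^ 2 / 2) + C / (n : ℝ) ^ τ ∧
      ∀ p : ℕ, ‖complexMGF (trigSum a m n) volume (Complex.I * (t : ℂ) / (trigScale a n : ℂ))‖ ≤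
        2 * p * n ^ p * Real.exp (-t ^ 2 / 2) + C * p.factorial * (2 / (n : ℝ) ^ τ) ^ p := by
  obtain ⟨C, hC0, hC⟩ := exists_norm_charFun_le hm.1
  refine ⟨C, hC0, fun K hK => ?_⟩
  have e1 : ∀ᶠ n in atTop, C * (K * maxCoeff a n) < 1 := by
    have h := (hd.const_mul K).const_mul C
    rw [mul_zero, mul_zero] at h
    exact h.eventually_lt_const one_pos
  have e2 : ∀ᶠ n : ℕ in atTop, q ≤ 2 → C * (n * (K * maxCoeff a n) ^ 3) < 1 := by
    by_cases h2 : q ≤ 2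
    · have h := (hd3 h2).const_mul (C * K ^ 3)
      rw [mul_zero] at h
      filter_upwards [h.eventually_lt_const one_pos] with n hn _
      calc _ = C * K ^ 3 * (n * maxCoeff a n ^ 3) := by ring
        _ < 1 := hn
    · exact Eventually.of_forall fun n h => absurd h h2
  have e3 : ∀ᶠ n : ℕ in atTop, C * ((n : ℝ) ^ τ * (K * maxCoeff a n) ^ 2) < 1 := by
    have h := hd2.const_mul (C * K ^ 2)
    rw [mul_zero] at h
    filter_upwards [h.eventually_lt_const one_pos] with n hn
    calc _ = C * K ^ 2 * ((n : ℝ) ^ τ * maxCoeff a n ^ 2) := by ring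
      _ < 1 := hn
  have e4 : ∀ᶠ n : ℕ in atTop, n * ((n : ℝ) ^ τ * (K * maxCoeff a n) ^ 2) ^ 2 < 1 := by
    have h := hd4.const_mul (K ^ 4)
    rw [mul_zero] at h
    filter_upwards [h.eventually_lt_const one_pos] with n hn
    calc _ = K ^ 4 * (n * ((n : ℝ) ^ τ * maxCoeff a n ^ 2) ^ 2) := by ring
      _ < 1 := hn
  have e5 : ∀ᶠ n : ℕ in atTop, 4 ≤ (n : ℝ) ^ τ :=
    ((tendsto_rpow_atTop hτ).comp tendsto_natCast_atTop_atTop).eventually_ge_atTop 4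
  filter_upwards [e1, e2, e3, e4, e5, eventually_ge_atTop 1, hA.eventually_ge_atTop 1]
    with n h1 h2 h3 h4 h5 hn hA1 t ht
  have hApos : 0 < trigScale a n := by linarith
  have hu : |t / trigScale a n| ≤ K := by
    rw [abs_div, abs_of_pos hApos, div_le_iff₀ hApos, mul_comm]
    exact ht
  have hα : ∀ k ∈ Finset.Icc 1 n, |t / trigScale a n * a k n| ≤ K * maxCoeff a n := fun k hk => by
    rw [abs_mul]
    exact mul_le_mul hu (abs_le_maxCoeff a hk) (abs_nonneg _) hK
  have hsum : -(1 / 4) * ∑ k ∈ Finset.Icc 1 n, (t / trigScale a n * a k n) ^ 2 = -t ^ 2 / 2 := by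
    simp_rw [mul_pow]
    rw [← Finset.mul_sum]
    have h6 : ∑ k ∈ Finset.Icc 1 n, a k n ^ 2 = 2 * trigScale a n ^ 2 := by
      rw [trigScale_sq]; ring
    rw [h6]
    field_simp
    ring
  have key := hC m hm (fun k => t / trigScale a n * a k n) n (K * maxCoeff a n) ((n : ℝ) ^ τ) hn hα
    (mul_nonneg hK (maxCoeff_nonneg a n)) h1.le (fun h => (h2 h).le) h5 h3.le h4.le
  rw [hsum] at key
  rw [complexMGF_trigSum_eq]
  exact key

lemma memLp_truncatedCharFun (a : ℕ → ℕ → ℝ) (m : ℕ → ℤ) (n : ℕ) (A K : ℝ) :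
    MemLp (truncatedCharFun (volume : Measure unitInterval) (trigSum a m n) A K) 1
      (volume : Measure ℝ) := by
  have hset : {t : ℝ | |t| ≤ A * K} = Set.Icc (-(A * K)) (A * K) := by
    ext t
    simp only [Set.mem_ofPred_eq, Set.mem_Icc, abs_le]
  have hprob : IsProbabilityMeasure ((volume : Measure unitInterval).map (trigSum a m n)) :=
    Measure.isProbabilityMeasure_map (continuous_trigSum a m n).aemeasurable
  rw [memLp_one_iff_integrable, truncatedCharFun, hset]
  simp_rw [complexMGF_trigSum_eq_charFun]
  rw [integrable_indicator_iff measurableSet_Icc]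
  refine Measure.integrableOn_of_bounded (M := 1) ?_ ?_ ?_
  · exact measure_Icc_lt_top.ne
  · exact (measurable_charFun.comp (measurable_id.div_const A)).aestronglyMeasurable
  · exact Eventually.of_forall fun t => norm_charFun_le_one _

lemma tendsto_complexMGF_trigSum {C : ℝ} (hA : Tendsto (trigScale a) atTop atTop) (hτ : 0 < τ)
    (hd3 : q ≤ 2 → Tendsto (fun n : ℕ => n * maxCoeff a n ^ 3) atTop (𝓝 0)) (t : ℝ)
    (h : ∀ᶠ n : ℕ in atTop, ∀ s : ℝ, |s| ≤ trigScale a n * |t| →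
      ‖complexMGF (trigSum a m n) volume (Complex.I * (s : ℂ) / (trigScale a n : ℂ)) -
          ((Real.exp (-s ^ 2 / 2) : ℝ) : ℂ)‖ ≤
        (if q ≤ 2 then C * (n * (|t| * maxCoeff a n) ^ 3) else 0) + C / (n : ℝ) ^ τ) :
    Tendsto (fun n => complexMGF (trigSum a m n) volume
      (Complex.I * (t : ℂ) / (trigScale a n : ℂ))) atTop (𝓝 (Complex.exp (-(t : ℂ) ^ 2 / 2))) := by
  have h1 : Tendsto (fun n : ℕ => if q ≤ 2 then C * (n * (|t| * maxCoeff a n) ^ 3) else 0) atTop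
      (𝓝 0) := by
    split_ifs with h2
    · have h3 := (hd3 h2).const_mul (C * |t| ^ 3)
      rw [mul_zero] at h3
      exact h3.congr fun n => by ring
    · exact tendsto_const_nhds
  have h2 : Tendsto (fun n : ℕ => C / (n : ℝ) ^ τ) atTop (𝓝 0) :=
    tendsto_const_nhds.div_atTop ((tendsto_rpow_atTop hτ).comp tendsto_natCast_atTop_atTop)
  have h3 := h1.add h2
  rw [add_zero] at h3
  have hE : Complex.exp (-(t : ℂ) ^ 2 / 2) = ((Real.exp (-t ^ 2 / 2) : ℝ) : ℂ) := by
    push_cast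
    rfl
  rw [hE, tendsto_iff_norm_sub_tendsto_zero]
  refine squeeze_zero' (Eventually.of_forall fun n => norm_nonneg _) ?_ h3
  filter_upwards [h, hA.eventually_ge_atTop 1] with n hn hA1
  exact hn t (le_mul_of_one_le_left (abs_nonneg t) hA1)

/-- The function dominating `truncatedCharFun` in excess of a Gaussian: an error of order `n ^ (-τ)`
for `|t| ≤ n ^ (τ / 2)`, and of order `n ^ (-2)` on the whole support. -/
noncomputable def tailError (D τ R : ℝ) (n : ℕ) (t : ℝ) : ℝ :=
  (Set.Icc (-(n : ℝ) ^ (τ / 2)) ((n : ℝ) ^ (τ / 2))).indicator (fun _ => D / (n : ℝ) ^ τ) t +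
    (Set.Icc (-R) R).indicator (fun _ => D / (n : ℝ) ^ 2) t

lemma tailError_nonneg {D τ : ℝ} (hD : 0 ≤ D) (R : ℝ) (n : ℕ) (t : ℝ) :
    0 ≤ tailError D τ R n t :=
  add_nonneg (Set.indicator_nonneg (fun _ _ => by positivity) _)
    (Set.indicator_nonneg (fun _ _ => by positivity) _)

lemma integrable_indicator_Icc_const (x y c : ℝ) :
    Integrable ((Set.Icc x y).indicator fun _ => c) := by
  rw [integrable_indicator_iff measurableSet_Icc]
  exact integrableOn_const measure_Icc_lt_top.ne

lemma integrable_tailError (D τ R : ℝ) (n : ℕ) : Integrable (tailError D τ R n) :=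
  (integrable_indicator_Icc_const _ _ _).add (integrable_indicator_Icc_const _ _ _)

lemma integral_tailError (D τ : ℝ) {R : ℝ} (hR : 0 ≤ R) (n : ℕ) :
    ∫ t, tailError D τ R n t =
      2 * (n : ℝ) ^ (τ / 2) * (D / (n : ℝ) ^ τ) + 2 * R * (D / (n : ℝ) ^ 2) := by
  have hn : 0 ≤ (n : ℝ) ^ (τ / 2) := by positivity
  unfold tailError
  rw [integral_add (integrable_indicator_Icc_const _ _ _) (integrable_indicator_Icc_const _ _ _),
    integral_indicator_const _ measurableSet_Icc, integral_indicator_const _ measurableSet_Icc,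
    Real.volume_real_Icc_of_le (by linarith), Real.volume_real_Icc_of_le (by linarith)]
  simp only [smul_eq_mul]
  ring

lemma tendsto_integral_tailError {D K : ℝ} (hD : 0 ≤ D) (hK : 0 ≤ K) (hτ : 0 < τ)
    (hd : Tendsto (maxCoeff a) atTop (𝓝 0)) :
    Tendsto (fun n => ∫ t, tailError D τ (trigScale a n * K) n t) atTop (𝓝 0) := by
  have h1 : Tendsto (fun n : ℕ => 2 * D / (n : ℝ) ^ (τ / 2)) atTop (𝓝 0) :=
    tendsto_const_nhds.div_atTop
      ((tendsto_rpow_atTop (by linarith)).comp tendsto_natCast_atTop_atTop)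
  have h2 : Tendsto (fun n : ℕ => 2 * K * D / (n : ℝ)) atTop (𝓝 0) :=
    tendsto_const_nhds.div_atTop tendsto_natCast_atTop_atTop
  have h3 := h1.add h2
  rw [add_zero] at h3
  refine squeeze_zero' (Eventually.of_forall fun n =>
    integral_nonneg fun t => tailError_nonneg hD _ _ _) ?_ h3
  filter_upwards [hd.eventually_le_const one_pos, eventually_ge_atTop 1] with n hn hn1
  have hn' : (0 : ℝ) < n := by exact_mod_cast hn1
  rw [integral_tailError D τ (mul_nonneg (trigScale_nonneg a n) hK)]
  refine add_le_add (le_of_eq ?_) ?_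
  · have h4 : (n : ℝ) ^ τ = (n : ℝ) ^ (τ / 2) * (n : ℝ) ^ (τ / 2) := by
      rw [← Real.rpow_add hn', add_halves]
    have h5 : 0 < (n : ℝ) ^ (τ / 2) := by positivity
    rw [h4]
    field_simp
  · calc 2 * (trigScale a n * K) * (D / (n : ℝ) ^ 2) ≤ 2 * (n * K) * (D / (n : ℝ) ^ 2) := by
          gcongr
          exact trigScale_le a hn
      _ = 2 * K * D / n := by field_simp

/-- For `|t| > n ^ (τ / 2)` half of the Gaussian exponent absorbs a power of `n`. -/
lemma eventually_pow_mul_exp_le (hτ : 0 < τ) (p : ℕ) :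
    ∀ᶠ n : ℕ in atTop, 2 * p * (n : ℝ) ^ p * Real.exp (-(1 / 4) * (n : ℝ) ^ τ) ≤ 1 := by
  have h1 := (tendsto_rpow_mul_exp_neg_mul_atTop_nhds_zero (p / τ) (1 / 4) (by norm_num)).comp
    ((tendsto_rpow_atTop hτ).comp tendsto_natCast_atTop_atTop)
  have h2 := h1.const_mul (2 * p : ℝ)
  rw [mul_zero] at h2
  filter_upwards [h2.eventually_le_const one_pos] with n hn
  simp only [Function.comp_apply] at hn
  rw [← Real.rpow_mul (Nat.cast_nonneg n), mul_div_cancel₀ _ hτ.ne', Real.rpow_natCast] at hn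
  linarith

lemma exists_eventually_norm_truncatedCharFun_le {C K : ℝ} (hC : 0 < C) (hτ : 0 < τ)
    (h : ∀ᶠ n : ℕ in atTop, ∀ t : ℝ, |t| ≤ trigScale a n * K →
      ‖complexMGF (trigSum a m n) volume (Complex.I * (t : ℂ) / (trigScale a n : ℂ))‖ ≤
        2 * Real.exp (-t ^ 2 / 2) + C / (n : ℝ) ^ τ ∧
      ∀ p : ℕ, ‖complexMGF (trigSum a m n) volume (Complex.I * (t : ℂ) / (trigScale a n : ℂ))‖ ≤
        2 * p * n ^ p * Real.exp (-t ^ 2 / 2) + C * p.factorial * (2 / (n : ℝ) ^ τ) ^ p) :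
    ∃ D : ℝ, 0 ≤ D ∧ ∀ᶠ n : ℕ in atTop, ∀ t : ℝ,
      ‖truncatedCharFun (volume : Measure unitInterval) (trigSum a m n) (trigScale a n) K t‖ ≤
        2 * Real.exp (-(1 / 4) * t ^ 2) + tailError D τ (trigScale a n * K) n t := by
  -- The power `p` is chosen such that `n ^ (-τ p) ≤ n ^ (-2)`.
  obtain ⟨p, hp⟩ := exists_nat_ge (2 / τ)
  have hp' : 2 ≤ τ * p := by rw [div_le_iff₀ hτ] at hp; linarith
  refine ⟨max C (C * p.factorial * 2 ^ p), le_max_of_le_left hC.le, ?_⟩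
  set D := max C (C * p.factorial * 2 ^ p) with hD
  have hD0 : 0 ≤ D := le_max_of_le_left hC.le
  filter_upwards [h, eventually_pow_mul_exp_le hτ p, eventually_ge_atTop 1] with n hn hpn hn1 t
  have hn' : (1 : ℝ) ≤ n := by exact_mod_cast hn1
  have hn0 : (0 : ℝ) < n := by linarith
  by_cases ht : |t| ≤ trigScale a n * K
  · have hmem : t ∈ {t : ℝ | |t| ≤ trigScale a n * K} := ht
    rw [truncatedCharFun, Set.indicator_of_mem hmem]
    obtain ⟨h1, h2⟩ := hn t ht
    have hsplit : Real.exp (-t ^ 2 / 2) =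
        Real.exp (-(1 / 4) * t ^ 2) * Real.exp (-(1 / 4) * t ^ 2) := by
      rw [← Real.exp_add]; ring_nf
    have hG0 := Real.exp_pos (-(1 / 4) * t ^ 2)
    have hG1 : Real.exp (-(1 / 4) * t ^ 2) ≤ 1 := by
      rw [Real.exp_le_one_iff]
      nlinarith [sq_nonneg t]
    rw [tailError]
    by_cases ht2 : |t| ≤ (n : ℝ) ^ (τ / 2)
    · rw [Set.indicator_of_mem (show t ∈ Set.Icc (-(n : ℝ) ^ (τ / 2)) ((n : ℝ) ^ (τ / 2)) from
        abs_le.1 ht2)]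
      have h3 : C / (n : ℝ) ^ τ ≤ D / (n : ℝ) ^ τ := by
        gcongr
        exact le_max_left _ _
      have h4 : 0 ≤ (Set.Icc (-(trigScale a n * K)) (trigScale a n * K)).indicator
          (fun _ => D / (n : ℝ) ^ 2) t := Set.indicator_nonneg (fun _ _ => by positivity) _
      rw [hsplit] at h1
      nlinarith
    · rw [Set.indicator_of_mem (show t ∈ Set.Icc (-(trigScale a n * K)) (trigScale a n * K) from
        abs_le.1 ht)]
      have h3 : 0 ≤ (Set.Icc (-(n : ℝ) ^ (τ / 2)) ((n : ℝ) ^ (τ / 2))).indicator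
          (fun _ => D / (n : ℝ) ^ τ) t := Set.indicator_nonneg (fun _ _ => by positivity) _
      have h4 : (n : ℝ) ^ τ ≤ t ^ 2 := by
        have h5 : (n : ℝ) ^ τ = ((n : ℝ) ^ (τ / 2)) ^ 2 := by
          rw [← Real.rpow_mul_natCast hn0.le]
          push_cast
          rw [div_mul_cancel₀ τ (by norm_num : (2 : ℝ) ≠ 0)]
        rw [h5, ← sq_abs t]
        exact pow_le_pow_left₀ (by positivity) (not_le.1 ht2).le 2
      have h5 : 2 * p * (n : ℝ) ^ p * Real.exp (-t ^ 2 / 2) ≤ Real.exp (-(1 / 4) * t ^ 2) := by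
        rw [hsplit, ← mul_assoc]
        refine mul_le_of_le_one_left hG0.le (le_trans ?_ hpn)
        have h6 : -(1 / 4) * t ^ 2 ≤ -(1 / 4) * (n : ℝ) ^ τ := by linarith
        gcongr
      have h6 : C * p.factorial * (2 / (n : ℝ) ^ τ) ^ p ≤ D / (n : ℝ) ^ 2 := by
        have h7 : (n : ℝ) ^ 2 ≤ ((n : ℝ) ^ τ) ^ p := by
          rw [← Real.rpow_mul_natCast hn0.le, ← Real.rpow_natCast]
          exact Real.rpow_le_rpow_of_exponent_le hn' (by exact_mod_cast hp')
        calc C * p.factorial * (2 / (n : ℝ) ^ τ) ^ p =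
              C * p.factorial * 2 ^ p / ((n : ℝ) ^ τ) ^ p := by rw [div_pow]; ring
          _ ≤ D / (n : ℝ) ^ 2 := by
            gcongr
            exact le_max_right _ _
      linarith [h2 p]
  · have hmem : t ∉ {t : ℝ | |t| ≤ trigScale a n * K} := ht
    rw [truncatedCharFun, Set.indicator_of_notMem hmem, norm_zero]
    exact add_nonneg (by positivity) (tailError_nonneg hD0 _ _ _)

lemma uniformIntegrable_truncatedCharFun {C K : ℝ} (hC : 0 < C) (hK : 0 ≤ K) (hτ : 0 < τ)
    (hA : Tendsto (trigScale a) atTop atTop) (hd : Tendsto (maxCoeff a) atTop (𝓝 0))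
    (hlim : ∀ t : ℝ, Tendsto (fun n => complexMGF (trigSum a m n) volume
      (Complex.I * (t : ℂ) / (trigScale a n : ℂ))) atTop (𝓝 (Complex.exp (-(t : ℂ) ^ 2 / 2))))
    (h : ∀ᶠ n : ℕ in atTop, ∀ t : ℝ, |t| ≤ trigScale a n * K →
      ‖complexMGF (trigSum a m n) volume (Complex.I * (t : ℂ) / (trigScale a n : ℂ))‖ ≤
        2 * Real.exp (-t ^ 2 / 2) + C / (n : ℝ) ^ τ ∧
      ∀ p : ℕ, ‖complexMGF (trigSum a m n) volume (Complex.I * (t : ℂ) / (trigScale a n : ℂ))‖ ≤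
        2 * p * n ^ p * Real.exp (-t ^ 2 / 2) + C * p.factorial * (2 / (n : ℝ) ^ τ) ^ p) :
    UniformIntegrable (fun n => truncatedCharFun (volume : Measure unitInterval)
        (trigSum a m n) (trigScale a n) K) 1 (volume : Measure ℝ) ∧
      UnifTight (fun n => truncatedCharFun (volume : Measure unitInterval)
        (trigSum a m n) (trigScale a n) K) 1 (volume : Measure ℝ) := by
  obtain ⟨D, hD, hdom⟩ := exists_eventually_norm_truncatedCharFun_le hC hτ h
  have hG : Integrable fun t : ℝ => 2 * Real.exp (-(1 / 4) * t ^ 2) :=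
    (integrable_exp_neg_mul_sq (by norm_num)).const_mul 2
  -- For `K = 0` the functions vanish almost everywhere, and so does their limit.
  obtain ⟨g, hgm, hgG, hg⟩ : ∃ g : ℝ → ℂ, AEStronglyMeasurable g ∧
      (∀ t, ‖g t‖ ≤ 2 * Real.exp (-(1 / 4) * t ^ 2)) ∧
      ∀ᵐ t, Tendsto (fun n => truncatedCharFun (volume : Measure unitInterval)
        (trigSum a m n) (trigScale a n) K t) atTop (𝓝 (g t)) := by
    rcases hK.eq_or_lt with rfl | hK
    · refine ⟨0, aestronglyMeasurable_zero, fun t => by simpa using (Real.exp_pos _).le, ?_⟩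
      filter_upwards [Measure.ae_ne volume (0 : ℝ)] with t ht
      have h0 : ∀ n, truncatedCharFun (volume : Measure unitInterval)
          (trigSum a m n) (trigScale a n) 0 t = 0 := fun n => by
        rw [truncatedCharFun, Set.indicator_of_notMem]
        simpa using ht
      simp only [h0, Pi.zero_apply]
      exact tendsto_const_nhds
    · refine ⟨fun t => Complex.exp (-(t : ℂ) ^ 2 / 2), by fun_prop, fun t => ?_, ?_⟩
      · have h1 : Complex.exp (-(t : ℂ) ^ 2 / 2) = ((Real.exp (-t ^ 2 / 2) : ℝ) : ℂ) := by
          push_cast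
          rfl
        simp only [h1]
        rw [Complex.norm_real, Real.norm_eq_abs, abs_of_pos (Real.exp_pos _)]
        have h2 : Real.exp (-t ^ 2 / 2) ≤ Real.exp (-(1 / 4) * t ^ 2) :=
          Real.exp_le_exp.2 (by nlinarith [sq_nonneg t])
        linarith [Real.exp_pos (-(1 / 4) * t ^ 2)]
      · refine Eventually.of_forall fun t => (hlim t).congr' ?_
        filter_upwards [(hA.atTop_mul_const hK).eventually_ge_atTop |t|] with n hn
        rw [truncatedCharFun, Set.indicator_of_mem (show t ∈ {t : ℝ | |t| ≤ _} from hn)]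
  have hmem := fun n => memLp_truncatedCharFun a m n (trigScale a n) K
  have hgmem : MemLp g 1 volume :=
    memLp_one_iff_integrable.2 (hG.mono' hgm (Eventually.of_forall hgG))
  refine uniformIntegrable_and_unifTight_of_tendsto hmem hgmem ?_
  exact tendsto_eLpNorm_sub_of_dominated_add (fun n => (hmem n).1) hgm hg hG hgG
    (fun n => integrable_tailError D τ (trigScale a n * K) n)
    (fun n t => tailError_nonneg hD _ _ _) hdom (tendsto_integral_tailError hD hK hτ hd)

end ModGaussian

theorem theorem2p1 (m : ℕ → ℤ) (q : ℝ) (hm : IsLacunary m q) (a : ℕ → ℕ → ℝ)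
    (hA : Tendsto (trigScale a) atTop atTop)
    (hd : ∃ ε : ℝ, 0 < ε ∧
      (q ≤ 2 → Tendsto (fun n : ℕ => (n : ℝ) ^ (1 + ε) * maxCoeff a n ^ 3) atTop (𝓝 0)) ∧
      (2 < q → Tendsto (fun n : ℕ => (n : ℝ) ^ (1 + ε) * maxCoeff a n ^ 4) atTop (𝓝 0))) :
    ModGaussianConvergence (volume : Measure unitInterval) (trigSum a m) (trigScale a) := by
  obtain ⟨τ, hτ, hd1, hd2, hd4, hd3⟩ := exists_tendsto_maxCoeff hd
  obtain ⟨C, hC0, hC⟩ := exists_eventually_norm_complexMGF_le hm hA hτ hd1 hd2 hd4 hd3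
  have hlim : ∀ t : ℝ, Tendsto (fun n => complexMGF (trigSum a m n) volume
      (Complex.I * (t : ℂ) / (trigScale a n : ℂ))) atTop (𝓝 (Complex.exp (-(t : ℂ) ^ 2 / 2))) :=
    fun t => tendsto_complexMGF_trigSum hA hτ hd3 t
      ((hC |t| (abs_nonneg t)).mono fun n hn s hs => (hn s hs).1)
  exact
    { aemeasurable := fun n => (continuous_trigSum a m n).aemeasurable
      tendsto_scale := hA
      tendsto_charFun := hlim
      uniformIntegrable := fun K hK => uniformIntegrable_truncatedCharFun hC0 hK hτ hA hd1 hlim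
        ((hC K hK).mono fun n hn t ht => (hn t ht).2) }
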